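/- Let $p$ be a prime, let $q=p^e$, and let $K$ be a function field in one variable over $\mathbb{F}_q$ (a finite extension of $\mathbb{F}_q(t)$). Let $L/K$ be a finite abelian extension whose Galois group is a $p$-group. Let $\mathfrak p$ be a prime (place) of $K$, and let $f_{\mathfrak p}$ be its degree over $\mathbb{F}_q$. Let $\nu_{\mathfrak p}\ge 0$ be an integer, and assume that $L/K$ is ramified of depth at most $\nu_{\mathfrak p}$ at $\mathfrak p$: for every prime $\mathfrak P$ of $L$ above $\mathfrak p$, the ramification group $G_{\mathfrak P}^{\nu_{\mathfrak p}}$ in upper numbering (normalized as in Serre's *Local Fields*) is trivial. Let $G_{\mathfrak p}\subseteq\operatorname{Gal}(L/K)$ be the decomposition group of a prime of $L$ above $\mathfrak p$, let $d_p(G_{\mathfrak p})$ be its generator rank (minimal number of generators) and let $r_p(G_{\mathfrak p})=\dim_{\mathbb{F}_p}H^2(G_{\mathfrak p},\mathbb{Z}/p\mathbb{Z})$ be its relation rank. Then $$r_p(G_{\mathfrak p})-d_p(G_{\mathfrak p})\le\binom{e f_{\mathfrak p}(\nu_{\mathfrak p}-1)+1}{2}=\frac{\bigl(e f_{\mathfrak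 p}(\nu_{\mathfrak p}-1)\bigr)\bigl(e f_{\mathfrak p}(\nu_{\mathfrak p}-1)+1\bigr)}{2},$$ where $\binom{x}{2}=x(x-1)/2$ for every integer $x$. -/

import Mathlib

open scoped Pointwise

noncomputable section

universe u

/-- The `p`-relation rank `r_p(G)` of a finite `p`-group `G`: the dimension over `𝔽_p` of
`H²(G, ℤ/pℤ)`, with trivial action. (`ULift` only adjusts the universe level.) -/
def relationRank (p : ℕ) (G : Type u) [Group G] : ℕ :=
  Module.finrank (ULift.{u} (ZMod p))
    (groupCohomology (Rep.trivial (ULift.{u} (ZMod p)) G (ULift.{u} (ZMod p))) 2)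

/-! A prime (place) of a field `K` of algebraic functions over a finite field is a valuation
subring of `K` different from `K`; every such ring is a discrete valuation ring. A prime `P` of an
extension `L` lies above `𝔭` when `P ∩ K = 𝔭`, that is `P.comap (algebraMap K L) = 𝔭`. -/

/-- The elements of a finite subfield belong to every valuation subring. -/
theorem algebraMap_mem_valuationSubring (F : Type*) {K : Type*} [Field F] [Finite F] [Field K]
    [Algebra F K] (A : ValuationSubring K) (x : F) : algebraMap F K x ∈ A := by
  have hx : IsIntegral A (algebraMap F K x) := by
    have : Fintype F := Fintype.ofFinite F
    have h1 : 1 < Fintype.card F := Fintype.one_lt_card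
    refine ⟨Polynomial.X ^ Fintype.card F - Polynomial.X, ?_, ?_⟩
    · refine Polynomial.monic_X_pow_sub ?_
      rw [Polynomial.degree_X]
      exact_mod_cast h1
    · simp [← map_pow, FiniteField.pow_card]
  obtain ⟨y, hy⟩ := IsIntegrallyClosed.isIntegral_iff.mp hx
  rw [← hy]
  exact y.2

/-- The degree `f_𝔭` over the finite field `F` of a prime of `K`, given by its valuation ring `A`:
the degree over `F` of the residue field. -/
def placeDegree (F : Type*) {K : Type*} [Field F] [Finite F] [Field K] [Algebra F K]
    (A : ValuationSubring K) : ℕ :=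
  letI : Algebra F (IsLocalRing.ResidueField A) :=
    ((IsLocalRing.residue A).comp ((algebraMap F K).codRestrict A.toSubring
      (algebraMap_mem_valuationSubring F A))).toAlgebra
  Module.finrank F (IsLocalRing.ResidueField A)

section Ramification

variable (K : Type*) {L : Type*} [Field K] [Field L] [Algebra K L]

/-- The ramification group `G_u` in lower numbering at the prime of `L` with valuation ring `P`,
as a subgroup of the decomposition group `G_P`, for a real index `u ≥ -1`. For an integer `i ≥ -1`,
`G_i` consists of the `σ ∈ G_P` acting trivially on `P / 𝔪 ^ (i + 1)`, and `G_u = G_⌈u⌉`. -/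
def lowerRamificationGroup (P : ValuationSubring L) (u : ℝ) :
    Subgroup (P.decompositionSubgroup K) :=
  (IsLocalRing.maximalIdeal P ^ (⌈u⌉ + 1).toNat).toAddSubgroup.inertia (P.decompositionSubgroup K)

/-- The function `φ(u) = ∫₀ᵘ dt / (G_0 : G_t)`. (For `-1 < t ≤ 0` one has `G_t = G_0`.) -/
def herbrandPhi (P : ValuationSubring L) (u : ℝ) : ℝ :=
  ∫ t in (0 : ℝ)..u,
    (((lowerRamificationGroup K P t).relIndex (lowerRamificationGroup K P 0) : ℕ) : ℝ)⁻¹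

/-- The function `ψ`, inverse to the bijection `φ : [-1, ∞) → [-1, ∞)`. -/
def herbrandPsi (P : ValuationSubring L) : ℝ → ℝ :=
  Function.invFunOn (herbrandPhi K P) (Set.Ici (-1))

/-- The ramification group `G^v = G_{ψ(v)}` in upper numbering, for a real index `v ≥ -1`. -/
def upperRamificationGroup (P : ValuationSubring L) (v : ℝ) :
    Subgroup (P.decompositionSubgroup K) :=
  lowerRamificationGroup K P (herbrandPsi K P v)

variable (L) in
/-- `L/K` is ramified of depth at most `n` at the prime `𝔭` of `K`: the ramification groups `G_P^n`
in upper numbering are trivial for all primes `P` of `L` above `𝔭`. -/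
def RamifiedOfDepthAtMost (𝔭 : ValuationSubring K) (n : ℝ) : Prop :=
  ∀ P : ValuationSubring L, P.comap (algebraMap K L) = 𝔭 → upperRamificationGroup K P n = ⊥

end Ramification

end

/-! Let G be the decomposition group, a product of d nontrivial cyclic p-groups. Such a product has
dim H² ≤ d(d+1)/2 (`finrank_groupCohomology_two_le`) and rank at least d, so the relation rank
exceeds the rank by at most d(d-1)/2, and it remains to bound d by N = e f (ν-1) + 1. Since G has at
least p^d characters with values in ℤ/p, it suffices to find at most p^N of them
(`relationRank_le`), that is, at most p q^(ν-1), where q = p^(e f) is now the order of the residue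
field of 𝔭.

The count (`card_characters_le`) replaces local class field theory by Artin-Schreier theory over the
fixed field of G, without completing. Every character χ has a generator y with g y = y + χ(g), and
characters are filtered by the pole order of y^p - y. Those of pole order zero are determined by
their value at Frobenius, so there are at most p (`card_hasPoleOrderLE_zero`). Each further step of
the filtration multiplies the count by at most q, because the residue of the leading coefficient
separates characters modulo the previous step (`card_hasPoleOrderLE_succ`).

The depth hypothesis bounds all pole orders by ν-1 (`hasPoleOrderLE_of_ramification`). As finite
fields are perfect, a minimal pole order m > 0 is prime to p. Then the degree p extension cut out by
χ has its break at m, and one half of Herbrand's theorem on quotients (`exists_ramification_break`)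
yields an s with G_s ≠ 1 and φ(s) ≥ m. Triviality of G^ν = G_ψ(ν) forces s < ψ(ν), hence m < ν.

The remaining lemmas show that places of function fields are discrete with finite residue fields,
and that G is generated by inertia and a Frobenius element (`exists_frobenius`). -/

noncomputable section

/-! ### The second cohomology of a finite abelian `p`-group -/

section Splitting

variable {G A : Type*} [Group G] [AddCommGroup A]

/-- The set underlying the central extension of `G` by `A` given by a `2`-cocycle. -/
@[ext]
structure CocycleExtension (_f : G × G → A) where
  /-- The component in the kernel. -/
  val : A
  /-- The image in the quotient. -/
  base : G

/-- The group law on `A × G` twisted by a `2`-cocycle. -/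
abbrev CocycleExtension.group (f : G × G → A)
    (hf : ∀ g h j, f (g * h, j) + f (g, h) = f (h, j) + f (g, h * j)) :
    Group (CocycleExtension f) :=
  letI : Mul (CocycleExtension f) :=
    ⟨fun x y => ⟨x.val + y.val + f (x.base, y.base), x.base * y.base⟩⟩
  letI : One (CocycleExtension f) := ⟨⟨-f (1, 1), 1⟩⟩
  letI : Inv (CocycleExtension f) :=
    ⟨fun x => ⟨-x.val - f (x.base⁻¹, x.base) - f (1, 1), x.base⁻¹⟩⟩
  Group.ofLeftAxioms
    (fun x y z => CocycleExtension.ext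
      (by
        change x.val + y.val + f (x.base, y.base) + z.val + f (x.base * y.base, z.base)
          = x.val + (y.val + z.val + f (y.base, z.base)) + f (x.base, y.base * z.base)
        have := hf x.base y.base z.base
        rw [← sub_eq_zero] at this ⊢
        rw [← this]; abel)
      (mul_assoc _ _ _))
    (fun x => CocycleExtension.ext
      (by
        change -f (1, 1) + x.val + f (1, x.base) = x.val
        have := hf 1 1 x.base
        simp only [one_mul] at this
        rw [← add_left_cancel this]; abel)
      (one_mul _))
    (fun x => CocycleExtension.ext
      (by
        change -x.val - f (x.base⁻¹, x.base) - f (1, 1) + x.val + f (x.base⁻¹, x.base) = -f (1, 1)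
        abel)
      (inv_mul_cancel _))

variable {ι : Type*} [Fintype ι] [DecidableEq ι] {n : ι → ℕ}

/-- A `2`-cocycle on a product of finite cyclic groups is a coboundary when the generators have
commuting lifts to the extension whose orders do not increase. -/
theorem exists_coboundary_of_lifts (e : G ≃* ((i : ι) → Multiplicative (ZMod (n i))))
    (hn : ∀ i, n i ≠ 0) (g : ι → G)
    (hg : ∀ i, e (g i) = Pi.mulSingle i (Multiplicative.ofAdd 1)) (f : G × G → A)
    (hf : ∀ g h j, f (g * h, j) + f (g, h) = f (h, j) + f (g, h * j))
    (hcomm : ∀ i j, f (g i, g j) = f (g j, g i))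
    (hpow : ∀ i, ∑ k ∈ Finset.range (n i), f (g i ^ k, g i) = 0) :
    ∃ c : G → A, ∀ x y, c y - c (x * y) + c x = f (x, y) := by
  let := CocycleExtension.group f hf
  have hmul : ∀ x y : CocycleExtension f,
    x * y = ⟨x.val + y.val + f (x.base, y.base), x.base * y.base⟩ := fun _ _ => rfl
  have hone : (1 : CocycleExtension f) = ⟨-f (1, 1), 1⟩ := rfl
  have hcommG : ∀ x y : G, x * y = y * x := fun x y => e.injective (by
    rw [map_mul, map_mul, mul_comm])
  let x : ι → CocycleExtension f := fun i => ⟨0, g i⟩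
  -- The unit of the extension is `(-f (1, 1), 1)`, so `hpow` says exactly that `x i ^ n i = 1`.
  have hxpow : ∀ i k, x i ^ k = ⟨∑ j ∈ Finset.range k, f (g i ^ j, g i) - f (1, 1), g i ^ k⟩ := by
    intro i k
    induction k with
    | zero => rw [pow_zero, hone]; simp
    | succ k ih =>
      rw [pow_succ, ih, hmul, Finset.sum_range_succ]
      refine CocycleExtension.ext ?_ (pow_succ _ _).symm
      simp only [x]
      abel
  have hxn : ∀ i, x i ^ n i = 1 := by
    intro i
    rw [hxpow, hpow, hone, zero_sub]
    have : g i ^ n i = 1 := e.injective (by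
      rw [map_pow, hg, ← Pi.mulSingle_pow, ← ofAdd_nsmul]; simp)
    rw [this]
  let ψ : ∀ i, Multiplicative (ZMod (n i)) →* CocycleExtension f := fun i =>
    AddMonoidHom.toMultiplicativeLeft (ZMod.lift (n i)
      ⟨zmultiplesHom (Additive (CocycleExtension f)) (Additive.ofMul (x i)), by
        simp only [zmultiplesHom_apply, natCast_zsmul]
        rw [← ofMul_pow, hxn, ofMul_one]⟩)
  have hψ1 : ∀ i, ψ i (Multiplicative.ofAdd 1) = x i := by
    intro i
    simp only [ψ, AddMonoidHom.coe_toMultiplicativeLeft, Function.comp_apply, toAdd_ofAdd]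
    rw [← Int.cast_one, ZMod.lift_coe]
    simp
  have hgen : ∀ i (y : Multiplicative (ZMod (n i))), ∃ k : ℕ, y = Multiplicative.ofAdd 1 ^ k := by
    intro i y
    have : NeZero (n i) := ⟨hn i⟩
    refine ⟨y.toAdd.val, ?_⟩
    rw [← ofAdd_nsmul, nsmul_one, ZMod.natCast_zmod_val]
    rfl
  have hc : Pairwise fun i j => ∀ a b, Commute (ψ i a) (ψ j b) := by
    intro i j _ a b
    obtain ⟨k, rfl⟩ := hgen i a
    obtain ⟨l, rfl⟩ := hgen j b
    rw [map_pow, map_pow, hψ1, hψ1]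
    refine Commute.pow_pow ?_ _ _
    rw [Commute, SemiconjBy, hmul, hmul]
    refine CocycleExtension.ext ?_ (hcommG _ _)
    simp only [x]
    rw [hcomm]
  -- Commuting lifts of the right orders assemble to a homomorphic section. Its kernel component, up
  -- to sign, is the cochain with coboundary `f`.
  let s := MonoidHom.noncommPiCoprod ψ hc
  let π : CocycleExtension f →* G :=
    { toFun := fun x => x.base, map_one' := rfl, map_mul' := fun _ _ => rfl }
  have hs : ∀ y, e (π (s y)) = y := by
    intro y
    suffices h : (e.toMonoidHom.comp π).comp s = MonoidHom.id _ from DFunLike.congr_fun h y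
    refine MonoidHom.pi_ext fun i a => ?_
    obtain ⟨k, rfl⟩ := hgen i a
    rw [Pi.mulSingle_pow, map_pow, map_pow]
    congr 1
    change e (π (s _)) = _
    rw [MonoidHom.noncommPiCoprod_mulSingle, hψ1]
    exact hg i
  refine ⟨fun y => -(s (e y)).val, fun a b => ?_⟩
  have h2 : ∀ a, (s (e a)).base = a := fun a => e.injective (hs (e a))
  have := congrArg CocycleExtension.val (hmul (s (e a)) (s (e b)))
  rw [← map_mul, ← map_mul] at this
  simp only [h2] at this
  simp only [this]
  abel

end Splitting

/-- The second cohomology, with trivial coefficients in a field, of a product of `d` cyclic groups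
has dimension at most `d (d + 1) / 2`. -/
theorem finrank_groupCohomology_two_le {k G : Type u} [Field k] [Group G]
    {ι : Type*} [Fintype ι] {n : ι → ℕ} (hn : ∀ i, n i ≠ 0)
    (e : G ≃* ((i : ι) → Multiplicative (ZMod (n i)))) :
    Module.finrank k (groupCohomology (Rep.trivial k G k) 2) ≤ (Fintype.card ι + 1).choose 2 := by
  classical
  let g : ι → G := fun i => e.symm (Pi.mulSingle i (Multiplicative.ofAdd 1))
  let A := Rep.trivial k G k
  -- The obstructions to splitting: on the diagonal the power of a lift, off the diagonal the
  -- commutator of two lifts. `out` orders a pair arbitrarily, which only affects a sign.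
  let Φ : groupCohomology.cocycles₂ A →ₗ[k] (Sym2 ι → k) :=
    LinearMap.pi fun z =>
      if z.out.1 = z.out.2 then
        ∑ j ∈ Finset.range (n z.out.1),
          (LinearMap.proj (g z.out.1 ^ j, g z.out.1) : (G × G → k) →ₗ[k] k) ∘ₗ
            (groupCohomology.cocycles₂ A).subtype
      else
        ((LinearMap.proj (g z.out.1, g z.out.2) : (G × G → k) →ₗ[k] k) -
          (LinearMap.proj (g z.out.2, g z.out.1) : (G × G → k) →ₗ[k] k)) ∘ₗ
            (groupCohomology.cocycles₂ A).subtype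
  let π := (groupCohomology.H2π A).hom
  have hπ : Function.Surjective π :=
    (ModuleCat.epi_iff_surjective _).mp inferInstance
  have hker : LinearMap.ker Φ ≤ LinearMap.ker π := by
    intro f hf
    rw [LinearMap.mem_ker] at hf ⊢
    have hf' : ∀ z, Φ f z = 0 := fun z => by rw [hf]; rfl
    refine (groupCohomology.H2π_eq_zero_iff f).mpr ?_
    have hout : ∀ i j : ι, (s(i, j).out.1 = i ∧ s(i, j).out.2 = j) ∨
        (s(i, j).out.1 = j ∧ s(i, j).out.2 = i) := by
      intro i j
      have : s(s(i, j).out.1, s(i, j).out.2) = s(i, j) := Quot.out_eq s(i, j)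
      exact Sym2.eq_iff.mp this
    obtain ⟨c, hc⟩ := exists_coboundary_of_lifts (A := k) e hn g (fun i => by simp [g]) f
      (fun g h j => (groupCohomology.mem_cocycles₂_iff (A := A) f).mp f.2 g h j)
      (fun i j => by
        by_cases hij : i = j
        · rw [hij]
        have := hf' s(i, j)
        rcases hout i j with ⟨h1, h2⟩ | ⟨h1, h2⟩
        · simp only [Φ, LinearMap.pi_apply, h1, h2, if_neg hij] at this
          simpa [sub_eq_zero] using this
        · simp only [Φ, LinearMap.pi_apply, h1, h2, if_neg (Ne.symm hij)] at this
          exact (sub_eq_zero.mp (by simpa using this)).symm)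
      (fun i => by
        have := hf' s(i, i)
        have h12 : s(i, i).out.1 = i ∧ s(i, i).out.2 = i := by
          rcases hout i i with h | h <;> exact h
        simp only [Φ, LinearMap.pi_apply, h12.1, h12.2, if_true] at this
        simpa using this)
    exact ⟨c, funext fun x => hc x.1 x.2⟩
  calc Module.finrank k (groupCohomology (Rep.trivial k G k) 2)
      = Module.finrank k (groupCohomology.cocycles₂ A ⧸ LinearMap.ker π) :=
        (LinearMap.quotKerEquivOfSurjective π hπ).finrank_eq.symm
    _ ≤ Module.finrank k (groupCohomology.cocycles₂ A ⧸ LinearMap.ker Φ) := by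
        have : Module.Finite k (groupCohomology.cocycles₂ A ⧸ LinearMap.ker Φ) :=
          Module.Finite.equiv Φ.quotKerEquivRange.symm
        exact LinearMap.finrank_le_finrank_of_surjective (f := Submodule.factor hker)
          (Submodule.factor_surjective hker)
    _ = Module.finrank k (LinearMap.range Φ) := Φ.quotKerEquivRange.finrank_eq
    _ ≤ Module.finrank k (Sym2 ι → k) := Submodule.finrank_le _
    _ = (Fintype.card ι + 1).choose 2 := by rw [Module.finrank_fintype_fun_eq_card, Sym2.card]

/-! ### Characters of finite abelian `p`-groups -/

/-- A finite abelian `p`-group is a product of nontrivial cyclic `p`-groups. -/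
theorem exists_mulEquiv_pi_zmod_of_isPGroup (p : ℕ) [Fact p.Prime] (G : Type*) [Group G]
    [Finite G] (hcomm : ∀ a b : G, a * b = b * a) (hG : IsPGroup p G) :
    ∃ (ι : Type) (_ : Fintype ι) (n : ι → ℕ), (∀ i, n i ≠ 0) ∧ (∀ i, p ∣ n i) ∧
      Nonempty (G ≃* ((i : ι) → Multiplicative (ZMod (n i)))) := by
  classical
  let : CommGroup G := { mul_comm := hcomm }
  obtain ⟨ι, _, n, hn, ⟨e⟩⟩ := CommGroup.equiv_prod_multiplicative_zmod_of_finite G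
  refine ⟨ι, inferInstance, n, fun i => by have := hn i; omega, fun i => ?_, ⟨e⟩⟩
  obtain ⟨k, hk⟩ := hG (e.symm (Pi.mulSingle i (Multiplicative.ofAdd 1)))
  have h1 : Multiplicative.ofAdd (1 : ZMod (n i)) ^ p ^ k = 1 := by
    have := congrArg (fun x => e x i) hk
    simpa using this
  rw [← ofAdd_nsmul, nsmul_one, ofAdd_eq_one, ZMod.natCast_eq_zero_iff] at h1
  obtain ⟨j, hj, h2⟩ := (Nat.dvd_prime_pow Fact.out).mp h1
  rw [h2]
  refine dvd_pow_self p ?_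
  rintro rfl
  have := hn i
  simp_all

section

variable {p : ℕ} [Fact p.Prime] {G : Type*} [Group G] {ι : Type*} {n : ι → ℕ}

/-- Every cyclic factor is reduced modulo `p`. This elementary abelian quotient bounds from below
both the rank and the number of characters. -/
theorem exists_surjective_pi_zmod (hp : ∀ i, p ∣ n i)
    (e : G ≃* ((i : ι) → Multiplicative (ZMod (n i)))) :
    ∃ f : G →* Multiplicative (ι → ZMod p), Function.Surjective f := by
  refine ⟨{ toFun := fun g =>
              Multiplicative.ofAdd fun i => ZMod.castHom (hp i) (ZMod p) (e g i).toAdd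
            map_one' := ?_
            map_mul' := ?_ }, ?_⟩
  · ext i; simp
  · intro x y
    ext i
    simp only [map_mul, Pi.mul_apply, toAdd_mul, map_add, toAdd_ofAdd, Pi.add_apply]
  · intro y
    choose x hx using fun i => ZMod.castHom_surjective (hp i) (y.toAdd i)
    refine ⟨e.symm fun i => Multiplicative.ofAdd (x i), ?_⟩
    ext i
    simpa using hx i

variable [Fintype ι]

/-- The minimal number of generators of a product of `d` nontrivial cyclic `p`-groups is at least
`d`. -/
theorem card_le_group_rank [Group.FG G] (hp : ∀ i, p ∣ n i)
    (e : G ≃* ((i : ι) → Multiplicative (ZMod (n i)))) : Fintype.card ι ≤ Group.rank G := by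
  obtain ⟨f, hf⟩ := exists_surjective_pi_zmod hp e
  obtain ⟨S, hS, hS'⟩ := Group.rank_spec G
  -- Generators of `G` map to a spanning set of the quotient vector space, which needs at least its
  -- dimension many elements.
  have hspan : Submodule.span (ZMod p) ((fun g => (f g).toAdd) '' (S : Set G)) = ⊤ := by
    rw [eq_top_iff]
    rintro y -
    obtain ⟨g, hg⟩ := hf (Multiplicative.ofAdd y)
    have : ∀ g ∈ Subgroup.closure (S : Set G),
        (f g).toAdd ∈ Submodule.span (ZMod p) ((fun g => (f g).toAdd) '' (S : Set G)) := by
      intro g hg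
      induction hg using Subgroup.closure_induction with
      | mem x hx => exact Submodule.subset_span ⟨x, hx, rfl⟩
      | one => simp
      | mul x y _ _ hx hy => rw [map_mul, toAdd_mul]; exact add_mem hx hy
      | inv x _ hx => rw [map_inv, toAdd_inv]; exact neg_mem hx
    have h := this g (hS' ▸ Subgroup.mem_top g)
    rwa [hg] at h
  classical
  have h1 := finrank_span_finset_le_card (R := ZMod p) (S.image fun g => (f g).toAdd)
  rw [Set.finrank, Finset.coe_image, hspan, finrank_top, Module.finrank_fintype_fun_eq_card] at h1
  exact h1.trans (Finset.card_image_le.trans hS.le)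

/-- Linear forms on the elementary abelian quotient pull back to characters of `G`, injectively
because the quotient map is onto. -/
theorem pow_card_le_card_monoidHom [Finite G] (hp : ∀ i, p ∣ n i)
    (e : G ≃* ((i : ι) → Multiplicative (ZMod (n i)))) :
    p ^ Fintype.card ι ≤ Nat.card (G →* Multiplicative (ZMod p)) := by
  classical
  obtain ⟨f, hf⟩ := exists_surjective_pi_zmod hp e
  have : Finite (G →* Multiplicative (ZMod p)) := DFunLike.finite _
  have hcard : Nat.card (ι → ZMod p) = p ^ Fintype.card ι := by simp
  rw [← hcard]
  refine Nat.card_le_card_of_injective (fun c =>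
    (AddMonoidHom.toMultiplicative ((Fintype.linearCombination (ZMod p) c).toAddMonoidHom :
      (ι → ZMod p) →+ ZMod p)).comp f) fun c c' h => ?_
  ext i
  obtain ⟨g, hg⟩ := hf (Multiplicative.ofAdd (Pi.single i 1))
  have := DFunLike.congr_fun h g
  simpa [hg, Fintype.linearCombination_apply_single] using this

end

/-- A finite abelian `p`-group with at most `p ^ N` characters of order `p` has relation rank at
most its generator rank plus `N.choose 2`. -/
theorem relationRank_le {p : ℕ} [Fact p.Prime] {G : Type u} [Group G] [Finite G]
    (hcomm : ∀ a b : G, a * b = b * a) (hG : IsPGroup p G) {N : ℕ}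
    (hN : Nat.card (G →* Multiplicative (ZMod p)) ≤ p ^ N) :
    relationRank p G ≤ Group.rank G + N.choose 2 := by
  obtain ⟨ι, _, n, hn, hp, ⟨e⟩⟩ := exists_mulEquiv_pi_zmod_of_isPGroup p G hcomm hG
  have h1 : relationRank p G ≤ (Fintype.card ι + 1).choose 2 :=
    finrank_groupCohomology_two_le hn e
  have h2 := card_le_group_rank hp e
  have h3 : Fintype.card ι ≤ N :=
    (Nat.pow_le_pow_iff_right (Fact.out : p.Prime).one_lt).mp
      ((pow_card_le_card_monoidHom hp e).trans hN)
  -- Pascal's rule: d+1 choose 2 is d plus d choose 2.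
  rw [Nat.choose_succ_succ' _ 1, Nat.choose_one_right, one_add_one_eq_two] at h1
  have := Nat.choose_le_choose 2 h3
  omega

/-! ### Finite groups acting on a discretely valued field -/

open WithZero

/-- Terms of a sum with pairwise distinct valuations are bounded by the sum. -/
theorem Valuation.map_le_map_sum_of_injOn {R ι Γ : Type*} [CommRing R]
    [LinearOrderedCommGroupWithZero Γ] (v : Valuation R Γ) (s : Finset ι) (f : ι → R)
    (h : ∀ i ∈ s, ∀ j ∈ s, v (f i) ≠ 0 → v (f i) = v (f j) → i = j) {i : ι} (hi : i ∈ s) :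
    v (f i) ≤ v (∑ j ∈ s, f j) := by
  classical
  obtain ⟨j, hj, hmax⟩ := s.exists_max_image (fun j => v (f j)) ⟨i, hi⟩
  refine (hmax i hi).trans ?_
  by_cases h0 : v (f j) = 0
  · rw [h0]; exact zero_le
  · rw [v.map_sum_eq_of_lt hj]
    intro k hk
    rw [Finset.mem_sdiff, Finset.mem_singleton] at hk
    exact (hmax k hk.1).lt_of_ne fun hkj => hk.2 (h j hj k hk.1 h0 hkj.symm).symm

theorem WithZero.exists_nat_le_exp {ι : Type*} [Finite ι] (f : ι → ℤᵐ⁰) :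
    ∃ M : ℕ, ∀ i, f i ≤ exp (M : ℤ) := by
  have := Fintype.ofFinite ι
  refine ⟨∑ i, (log (f i)).toNat, fun i => ?_⟩
  by_cases h : f i = 0
  · rw [h]; exact zero_le
  rw [← exp_log h, exp_le_exp]
  have := Finset.single_le_sum (f := fun i => (log (f i)).toNat) (fun _ _ => Nat.zero_le _)
    (Finset.mem_univ i)
  omega

section Action

variable {L G : Type*} [Field L] [Group G] [MulSemiringAction G L]

/-- Dedekind's independence of characters, applied to the distinct automorphisms given by the
faithful action. -/
theorem exists_sum_smul_ne_zero [Fintype G] [FaithfulSMul G L] (c : G → L) (hc : c ≠ 0) :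
    ∃ x : L, ∑ g, c g * g • x ≠ 0 := by
  by_contra! h
  have hinj : Function.Injective (fun g : G => MulDistribMulAction.toMonoidHom L g) :=
    fun g g' hgg => eq_of_smul_eq_smul (α := L) fun x => DFunLike.congr_fun hgg x
  have := (linearIndependent_monoidHom L L).comp _ hinj
  rw [Fintype.linearIndependent_iff] at this
  exact hc (funext (this c (funext fun x => by simpa using h x)))

theorem smul_castHom {p : ℕ} [CharP L p] (g : G) (i : ZMod p) :
    g • ZMod.castHom dvd_rfl L i = ZMod.castHom dvd_rfl L i :=
  DFunLike.congr_fun (RingHom.ext_zmod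
    ((MulSemiringAction.toRingHom G L g).comp (ZMod.castHom dvd_rfl L)) _) i

/-- Additive form of Hilbert's theorem 90, for characters of order `p`. -/
theorem exists_smul_eq_add_character [Finite G] [FaithfulSMul G L] (p : ℕ) [CharP L p]
    (χ : G →* Multiplicative (ZMod p)) :
    ∃ y : L, ∀ g : G, g • y = y + ZMod.castHom dvd_rfl L (χ g).toAdd := by
  have := Fintype.ofFinite G
  obtain ⟨x, hx⟩ := exists_sum_smul_ne_zero (L := L) (G := G) (fun _ => 1)
    (fun h => one_ne_zero (congrFun h 1))
  simp only [one_mul] at hx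
  set t := ∑ g : G, g • x with ht
  have hfix : ∀ g : G, g • t = t := fun g => by
    rw [ht, Finset.smul_sum]
    simp only [smul_smul]
    exact Fintype.sum_equiv (Equiv.mulLeft g) _ _ fun _ => rfl
  -- The trace `t` is fixed and nonzero, and S = ∑ χ(h) (h • x) satisfies g S = S - χ(g) t; hence
  -- -S/t works.
  refine ⟨-(∑ g : G, ZMod.castHom dvd_rfl L (χ g).toAdd * g • x) / t, fun g => ?_⟩
  have key : g • ∑ h : G, ZMod.castHom dvd_rfl L (χ h).toAdd * h • x
      = ∑ h : G, ZMod.castHom dvd_rfl L (χ h).toAdd * h • x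
        - ZMod.castHom dvd_rfl L (χ g).toAdd * t := by
    rw [Finset.smul_sum, ht, Finset.mul_sum, ← Finset.sum_sub_distrib]
    refine Fintype.sum_equiv (Equiv.mulLeft g) _ _ fun h => ?_
    rw [Equiv.coe_mulLeft, smul_mul', smul_castHom, map_mul, toAdd_mul, map_add, smul_smul]
    ring
  rw [div_eq_mul_inv, smul_mul', smul_inv'', hfix, smul_neg, key]
  field_simp
  ring

/-! ### Inertia and the ramification index. -/

section Valuation

variable (v : Valuation L ℤᵐ⁰)

/-- The higher ramification group of index `i ≥ 0` of a group of isometries of a discretely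
valued field. -/
def isometryRamificationGroup (hv : ∀ (g : G) (x : L), v (g • x) = v x) (i : ℕ) : Subgroup G where
  carrier := {g | ∀ c : L, v c ≤ 1 → v (g • c - c) ≤ exp (-((i : ℤ) + 1))}
  mul_mem' {a b} ha hb c hc := by
    rw [show (a * b) • c - c = (a • b • c - b • c) + (b • c - c) by rw [mul_smul]; ring]
    exact v.map_add_le (ha _ (by rwa [hv])) (hb c hc)
  one_mem' c _ := by simp
  inv_mem' {a} ha c hc := by
    rw [v.map_sub_swap]
    have := ha (a⁻¹ • c) (by rwa [hv])
    rwa [smul_inv_smul] at this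

variable {v}
variable {hv : ∀ (g : G) (x : L), v (g • x) = v x}

theorem WithZero.exp_neg_one_lt_one : (exp (-1 : ℤ)) < 1 := by
  rw [← exp_zero, exp_lt_exp]; norm_num

theorem WithZero.lt_one_iff_le_exp {x : ℤᵐ⁰} : x < 1 ↔ x ≤ exp (-1 : ℤ) := by
  by_cases h : x = 0
  · simp [h]
  · rw [← exp_log h, ← exp_zero, exp_lt_exp, exp_le_exp]; omega

variable (hv) in
/-- A prime power `N` such that `c ^ N` is close to `c` provides elements almost fixed by
inertia, in every residue class. -/
theorem map_smul_pow_sub_pow_le {p : ℕ} [Fact p.Prime] [CharP L p] {r : ℕ} (hr : r ≠ 0) {g : G}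
    (hg : g ∈ isometryRamificationGroup v hv 0) {b : L} (hb : v b ≤ 1) (k : ℕ) :
    v (g • b ^ (p ^ r) ^ k - b ^ (p ^ r) ^ k) ≤ exp (-(k : ℤ)) := by
  rw [smul_pow', ← pow_mul, ← sub_pow_char_pow, map_pow]
  calc v (g • b - b) ^ p ^ (r * k) ≤ exp (-1 : ℤ) ^ p ^ (r * k) :=
        pow_le_pow_left₀ zero_le (by simpa using hg b hb) _
    _ = exp (-((p ^ (r * k) : ℕ) : ℤ)) := by
        rw [← exp_nsmul]; simp
    _ ≤ exp (-(k : ℤ)) := by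
        rw [exp_le_exp, neg_le_neg_iff, Nat.cast_le]
        exact (Nat.le_mul_of_pos_left k (Nat.pos_of_ne_zero hr)).trans
          (Nat.lt_pow_self (Fact.out : p.Prime).one_lt).le

theorem map_pow_pow_sub_lt_one {N : ℕ} (hN : ∀ c, v c ≤ 1 → v (c ^ N - c) < 1) {b : L}
    (hb : v b ≤ 1) (k : ℕ) : v (b ^ N ^ k - b) < 1 := by
  induction k with
  | zero => simp
  | succ k ih =>
    have h1 : v (b ^ N ^ k) ≤ 1 := by rw [map_pow]; exact pow_le_one₀ zero_le hb
    rw [pow_succ, pow_mul, show (b ^ N ^ k) ^ N - b = ((b ^ N ^ k) ^ N - b ^ N ^ k)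
      + (b ^ N ^ k - b) by ring]
    exact v.map_add_lt (hN _ h1) ih

variable (hv) in
/-- The order of the inertia group is at most the ramification index. -/
theorem card_inertia_le [Finite G] [FaithfulSMul G L] {p : ℕ} [Fact p.Prime] [CharP L p] {r : ℕ}
    (hr : r ≠ 0) (hN : ∀ c, v c ≤ 1 → v (c ^ p ^ r - c) < 1) {π ϖ : L} {e : ℕ} (he : e ≠ 0)
    (hπ : v π = exp (-1 : ℤ)) (hϖ : v ϖ = exp (-(e : ℤ))) (hfix : ∀ g : G, g • ϖ = ϖ) :
    Nat.card (isometryRamificationGroup v hv 0) ≤ e := by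
  classical
  have := Fintype.ofFinite (isometryRamificationGroup v hv 0)
  rw [Nat.card_eq_fintype_card]
  by_contra! hlt
  -- With more than `e` elements in inertia, the `e` linear conditions ∑ c_g g(π^j) = 0, j < e, have
  -- a nonzero solution `c`. The operator `D` below will turn out to vanish on all integral
  -- elements, against Dedekind independence.
  let I := isometryRamificationGroup v hv 0
  let f : (I → L) →ₗ[L] (Fin e → L) :=
    LinearMap.pi fun j => ∑ g : I, (g • π ^ (j : ℕ)) • LinearMap.proj g
  obtain ⟨c, hcker, hc⟩ := (LinearMap.ker f).exists_mem_ne_zero_of_ne_bot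
    (LinearMap.ker_ne_bot_of_finrank_lt (by simpa using hlt))
  have hc0 : ∀ j < e, ∑ g : I, c g * g • π ^ j = 0 := by
    intro j hj
    have := congrFun hcker ⟨j, hj⟩
    simp only [f, LinearMap.pi_apply, LinearMap.sum_apply, LinearMap.smul_apply,
      LinearMap.proj_apply, smul_eq_mul, Pi.zero_apply] at this
    rw [← this]
    exact Finset.sum_congr rfl fun g _ => mul_comm _ _
  obtain ⟨M, hM⟩ := WithZero.exists_nat_le_exp fun g : I => v (c g)
  let D : L → L := fun a => ∑ g : I, c g * g • a
  have hadd : ∀ a b, D (a + b) = D a + D b := fun a b => by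
    simp only [D, smul_add, mul_add, Finset.sum_add_distrib]
  have hDle : ∀ a (t : ℤ), v a ≤ exp t → v (D a) ≤ exp (M + t) := by
    intro a t ha
    refine v.map_sum_le fun g _ => ?_
    rw [map_mul, exp_add]
    exact mul_le_mul' (hM g) (by change v ((g : G) • a) ≤ _; rwa [hv])
  have hvI : ∀ t : ℕ, v (ϖ ^ (t / e) * π ^ (t % e)) = exp (-(t : ℤ)) := by
    intro t
    rw [map_mul, map_pow, map_pow, hϖ, hπ, ← exp_nsmul, ← exp_nsmul, ← exp_add]
    congr 1
    have h : (e : ℤ) * (t / e : ℕ) + (t % e : ℕ) = t := by exact_mod_cast Nat.div_add_mod t e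
    rw [nsmul_eq_mul, nsmul_eq_mul]
    linarith
  -- Successive approximation by sums of `ϖ ^ i * π ^ j * b'` with j < e. `D` kills `ϖ ^ i * π ^ j`,
  -- and `b'`, an iterated `p ^ r`-th power, has the residue needed but is moved by inertia by at
  -- most `exp (-N)`. So `D a'` is small uniformly in `t`.
  have approx : ∀ (N : ℕ) (t : ℕ) (a : L), v a ≤ 1 →
      ∃ a', v (a - a') ≤ exp (-(t : ℤ)) ∧ v (D a') ≤ exp ((M : ℤ) - N) := by
    intro N t a ha
    induction t with
    | zero => exact ⟨0, by simpa using ha, by simp [D]⟩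
    | succ t ih =>
      obtain ⟨a', h1, h2⟩ := ih
      set w := ϖ ^ (t / e) * π ^ (t % e) with hw
      have hw0 : w ≠ 0 := by
        rw [← v.ne_zero_iff, hvI]; exact exp_ne_zero
      set b := (a - a') / w with hb
      have hb1 : v b ≤ 1 := by
        rw [hb, map_div₀, hvI]
        exact div_le_one_of_le₀ h1 zero_le
      set b' := b ^ (p ^ r) ^ N with hb'
      have hb'1 : v b' ≤ 1 := by rw [hb', map_pow]; exact pow_le_one₀ zero_le hb1
      refine ⟨a' + w * b', ?_, ?_⟩
      · have : a - (a' + w * b') = w * (-(b' - b)) := by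
          rw [hb]; field_simp; ring
        rw [this, map_mul, v.map_neg, hvI]
        have h3 := WithZero.lt_one_iff_le_exp.mp (map_pow_pow_sub_lt_one hN hb1 N)
        calc exp (-(t : ℤ)) * v (b' - b) ≤ exp (-(t : ℤ)) * exp (-1) := mul_le_mul_right h3 _
          _ = exp (-((t + 1 : ℕ) : ℤ)) := by rw [← exp_add]; congr 1; push_cast; ring
      · rw [hadd]
        refine v.map_add_le h2 ?_
        have hsplit : D (w * b') = ∑ g : I, c g * (g • w * (g • b' - b')) := by
          have h0 : ∑ g : I, c g * (g • w * b') = 0 := by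
            have : ∀ g : I, c g * (g • w * b') = ϖ ^ (t / e) * b' * (c g * g • π ^ (t % e)) := by
              intro g
              rw [hw, smul_mul', smul_pow', show g • ϖ = ϖ from hfix g]
              ring
            rw [Finset.sum_congr rfl fun g _ => this g, ← Finset.mul_sum,
              hc0 _ (Nat.mod_lt _ (Nat.pos_of_ne_zero he)), mul_zero]
          rw [← sub_zero (D (w * b')), ← h0, ← Finset.sum_sub_distrib]
          refine Finset.sum_congr rfl fun g _ => ?_
          rw [smul_mul']
          ring
        rw [hsplit]
        refine v.map_sum_le fun g _ => ?_
        rw [map_mul, map_mul, sub_eq_add_neg (M : ℤ), exp_add]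
        refine mul_le_mul' (hM g) ?_
        rw [← one_mul (exp (-(N : ℤ)))]
        refine mul_le_mul' ?_ (map_smul_pow_sub_pow_le hv hr g.2 hb1 N)
        change v ((g : G) • w) ≤ 1
        rw [hv, hvI, ← exp_zero, exp_le_exp]
        omega
  have hD0 : ∀ a, v a ≤ 1 → D a = 0 := by
    intro a ha
    by_contra h0
    have hbound : ∀ N : ℕ, v (D a) ≤ exp ((M : ℤ) - N) := by
      intro N
      obtain ⟨a', h1, h2⟩ := approx N N a ha
      rw [show a = (a - a') + a' by ring, hadd]
      exact v.map_add_le (hDle _ _ h1) h2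
    have h1 := hbound (M + (-log (v (D a))).toNat + 1)
    rw [← exp_log ((v.ne_zero_iff).mpr h0), exp_le_exp] at h1
    push_cast at h1
    simp only [log_exp] at h1
    omega
  obtain ⟨x, hx⟩ := exists_sum_smul_ne_zero (L := L) c hc
  obtain ⟨k, hk⟩ := WithZero.exists_nat_le_exp fun _ : Unit => v x
  have hϖ0 : ϖ ≠ 0 := by rw [← v.ne_zero_iff, hϖ]; exact exp_ne_zero
  -- A power of the fixed element `ϖ` makes `x` integral and passes through `D`.
  have h1 := hD0 (ϖ ^ k * x) (by
    rw [map_mul, map_pow, hϖ, ← exp_nsmul]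
    calc exp (k • (-(e : ℤ))) * v x ≤ exp (k • (-(e : ℤ))) * exp (k : ℤ) :=
          mul_le_mul_right (hk ()) _
      _ ≤ 1 := by
        rw [← exp_add, ← exp_zero, exp_le_exp, nsmul_eq_mul]
        have : 1 ≤ (e : ℤ) := by omega
        nlinarith)
  have h2 : D (ϖ ^ k * x) = ϖ ^ k * ∑ g : I, c g * g • x := by
    simp only [D, Finset.mul_sum]
    refine Finset.sum_congr rfl fun g _ => ?_
    rw [smul_mul', smul_pow', show g • ϖ = ϖ from hfix g]
    ring
  rw [h2] at h1
  exact hx ((mul_eq_zero.mp h1).resolve_left (pow_ne_zero _ hϖ0))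

end Valuation
end Action

/-! ### Uniformizers of the fixed field and generators of the valuation ring. -/

section Action

variable {L G : Type*} [Field L] [Group G] [MulSemiringAction G L]
variable {v : Valuation L ℤᵐ⁰} {hv : ∀ (g : G) (x : L), v (g • x) = v x}

variable (G) in
/-- The value group of the fixed field is generated by the value of a fixed element. -/
theorem exists_fixed_uniformizer [Finite G] (hv : ∀ (g : G) (x : L), v (g • x) = v x)
    {π : L} (hπ : v π = exp (-1 : ℤ)) :
    ∃ (e : ℕ) (ϖ : L), e ≠ 0 ∧ v ϖ = exp (-(e : ℤ)) ∧ (∀ g : G, g • ϖ = ϖ) ∧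
      ∀ z : L, (∀ g : G, g • z = z) → z ≠ 0 → ∃ n : ℤ, v z = exp (n * e) := by
  classical
  have := Fintype.ofFinite G
  -- The norm of `π` is a fixed element of positive order. For the least such order `e`, division
  -- with remainder shows that every value of a fixed element is a power of `exp e`.
  have hex : ∃ e : ℕ, e ≠ 0 ∧ ∃ ϖ : L, v ϖ = exp (-(e : ℤ)) ∧ ∀ g : G, g • ϖ = ϖ := by
    refine ⟨Fintype.card G, Fintype.card_ne_zero, ∏ g : G, g • π, ?_, fun g => ?_⟩
    · rw [map_prod]
      simp only [hv, hπ, Finset.prod_const, Finset.card_univ, ← exp_nsmul]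
      simp
    · rw [Finset.smul_prod']
      simp only [smul_smul]
      exact Fintype.prod_equiv (Equiv.mulLeft g) _ _ fun _ => rfl
  obtain ⟨he, ϖ, hϖ, hfix⟩ := Nat.find_spec hex
  set e := Nat.find hex
  refine ⟨e, ϖ, he, hϖ, hfix, fun z hz hz0 => ?_⟩
  have hz1 : v z ≠ 0 := (v.ne_zero_iff).mpr hz0
  refine ⟨log (v z) / e, ?_⟩
  by_contra hne
  have hmod : log (v z) % (e : ℤ) ≠ 0 := fun h => hne (by
    rw [← exp_log hz1, log_exp, exp_inj]
    exact (Int.ediv_mul_cancel (Int.dvd_of_emod_eq_zero h)).symm)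
  have h1 := Int.emod_nonneg (log (v z)) (b := (e : ℤ)) (by omega)
  have h2 := Int.emod_lt_of_pos (log (v z)) (b := (e : ℤ)) (by omega)
  have h3 := Int.emod_add_mul_ediv (log (v z)) (e : ℤ)
  refine Nat.find_min hex (m := (e - log (v z) % (e : ℤ)).toNat) (by omega)
    ⟨by omega, z * ϖ ^ (log (v z) / e + 1), ?_, fun g => ?_⟩
  · rw [map_mul, map_zpow₀, hϖ, ← exp_log hz1, log_exp, ← exp_zsmul, ← exp_add, exp_inj,
      Int.toNat_of_nonneg (by omega), smul_eq_mul]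
    linarith
  · rw [smul_mul', hz, smul_zpow₀', hfix]

/-- There is an integral element on which the ramification filtration can be read off. -/
theorem exists_ramification_generator {p : ℕ} [Fact p.Prime] [CharP L p] {r : ℕ} (hr : r ≠ 0)
    (hv : ∀ (g : G) (x : L), v (g • x) = v x)
    (hN : ∀ c, v c ≤ 1 → v (c ^ p ^ r - c) < 1) {π : L} (hπ : v π = exp (-1 : ℤ))
    {ξ : L} (hξ : v ξ ≤ 1) (hgen : ∀ c, v c ≤ 1 → v c < 1 ∨ ∃ n : ℕ, v (c - ξ ^ n) < 1) :
    ∃ x : L, v x ≤ 1 ∧ ∀ (g : G) (i : ℕ), v (g • x - x) ≤ exp (-((i : ℤ) + 1)) →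
      g ∈ isometryRamificationGroup v hv i := by
  have hp := (Fact.out : p.Prime)
  have hN2 : 2 ≤ p ^ r := hp.two_le.trans (Nat.le_self_pow hr p)
  have hπ1 : v π < 1 := by rw [hπ]; exact WithZero.exp_neg_one_lt_one
  -- `x` should lift the generator of the residue field and make `x ^ p ^ r - x` a uniformizer. If
  -- `ξ` fails the latter, that difference vanishes to order at least 2, and passing to `ξ + π` adds
  -- `π ^ p ^ r - π`, of order 1.
  obtain ⟨x, hx, hxN, hxξ⟩ : ∃ x : L, v x ≤ 1 ∧ v (x ^ p ^ r - x) = exp (-1 : ℤ) ∧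
      v (x - ξ) < 1 := by
    by_cases h : v (ξ ^ p ^ r - ξ) = exp (-1 : ℤ)
    · exact ⟨ξ, hξ, h, by simp⟩
    · refine ⟨ξ + π, v.map_add_le hξ hπ1.le, ?_, by simpa using hπ1⟩
      have h1 : v (ξ ^ p ^ r - ξ) < exp (-1 : ℤ) :=
        (WithZero.lt_one_iff_le_exp.mp (hN ξ hξ)).lt_of_ne h
      have h2 : v (π ^ p ^ r) < exp (-1 : ℤ) := by
        rw [map_pow, hπ, ← exp_nsmul, exp_lt_exp, nsmul_eq_mul]
        have : (2 : ℤ) ≤ (p ^ r : ℕ) := by exact_mod_cast hN2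
        linarith
      rw [add_pow_char_pow, show ξ ^ p ^ r + π ^ p ^ r - (ξ + π)
        = ((ξ ^ p ^ r - ξ) + π ^ p ^ r) - π by ring, ← hπ]
      refine v.map_sub_eq_of_lt_right ?_
      rw [hπ]
      exact v.map_add_lt h1 h2
  refine ⟨x, hx, fun g i hg => ?_⟩
  -- A ring containing `x` contains a uniformizer and representatives of all residues, so it
  -- approximates integral elements to any finite order. Order `i + 1` is enough here, hence
  -- completeness is not needed.
  let S : Subring L :=
    { carrier := {c | v c ≤ 1 ∧ v (g • c - c) ≤ exp (-((i : ℤ) + 1))}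
      mul_mem' := by
        rintro a b ⟨ha, ha'⟩ ⟨hb, hb'⟩
        refine ⟨by rw [map_mul]; exact mul_le_one' ha hb, ?_⟩
        rw [smul_mul', show g • a * g • b - a * b = g • a * (g • b - b) + (g • a - a) * b by ring]
        refine v.map_add_le ?_ ?_
        · rw [map_mul, hv]; exact mul_le_of_le_one_of_le ha hb'
        · rw [map_mul]; exact mul_le_of_le_of_le_one ha' hb
      one_mem' := by simp
      add_mem' := by
        rintro a b ⟨ha, ha'⟩ ⟨hb, hb'⟩
        refine ⟨v.map_add_le ha hb, ?_⟩
        rw [smul_add, show g • a + g • b - (a + b) = (g • a - a) + (g • b - b) by ring]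
        exact v.map_add_le ha' hb'
      zero_mem' := by simp
      neg_mem' := by
        rintro a ⟨ha, ha'⟩
        refine ⟨by rwa [v.map_neg], ?_⟩
        rwa [smul_neg, show -(g • a) - -a = -(g • a - a) by ring, v.map_neg] }
  have hxS : x ∈ S := ⟨hx, hg⟩
  set ϖ := x ^ p ^ r - x with hϖ
  have hϖS : ϖ ∈ S := S.sub_mem (S.pow_mem hxS _) hxS
  have hϖ0 : ϖ ≠ 0 := by rw [← v.ne_zero_iff, hxN]; exact exp_ne_zero
  have hpow : ∀ n : ℕ, v (ϖ ^ n) = exp (-(n : ℤ)) := fun n => by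
    rw [map_pow, hxN, ← exp_nsmul]; simp
  have hres : ∀ c, v c ≤ 1 → ∃ t ∈ S, v (c - t) < 1 := by
    intro c hc
    rcases hgen c hc with h | ⟨n, h⟩
    · exact ⟨0, S.zero_mem, by simpa using h⟩
    · refine ⟨x ^ n, S.pow_mem hxS n, ?_⟩
      rw [show c - x ^ n = (c - ξ ^ n) - (x ^ n - ξ ^ n) by ring]
      refine v.map_sub_lt h ?_
      obtain ⟨d, hd⟩ : ∃ d, v d ≤ 1 ∧ x ^ n - ξ ^ n = (x - ξ) * d := by
        refine ⟨∑ j ∈ Finset.range n, x ^ j * ξ ^ (n - 1 - j), v.map_sum_le fun j _ => ?_, ?_⟩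
        · rw [map_mul, map_pow, map_pow]
          exact mul_le_one' (pow_le_one' hx _) (pow_le_one' hξ _)
        · rw [mul_comm, Commute.geom_sum₂_mul (Commute.all _ _)]
      rw [hd.2, map_mul]
      exact mul_lt_of_lt_of_le_one hxξ hd.1
  have approx : ∀ (n : ℕ) (c : L), v c ≤ 1 → ∃ s ∈ S, v (c - s) ≤ exp (-(n : ℤ)) := by
    intro n c hc
    induction n with
    | zero => exact ⟨0, S.zero_mem, by simpa using hc⟩
    | succ n ih =>
      obtain ⟨s, hs, hs'⟩ := ih
      have h1 : v ((c - s) / ϖ ^ n) ≤ 1 := by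
        rw [map_div₀, hpow]; exact div_le_one_of_le₀ hs' zero_le
      obtain ⟨t, ht, ht'⟩ := hres _ h1
      refine ⟨s + ϖ ^ n * t, S.add_mem hs (S.mul_mem (S.pow_mem hϖS n) ht), ?_⟩
      rw [show c - (s + ϖ ^ n * t) = ϖ ^ n * ((c - s) / ϖ ^ n - t) by
        field_simp; ring, map_mul, hpow]
      calc exp (-(n : ℤ)) * v ((c - s) / ϖ ^ n - t) ≤ exp (-(n : ℤ)) * exp (-1) :=
            mul_le_mul_right (WithZero.lt_one_iff_le_exp.mp ht') _
        _ = exp (-((n + 1 : ℕ) : ℤ)) := by rw [← exp_add]; congr 1; push_cast; ring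
  intro c hc
  obtain ⟨s, hs, hs'⟩ := approx (i + 1) c hc
  push_cast at hs'
  rw [show g • c - c = g • (c - s) + (g • s - s) - (c - s) by rw [smul_sub]; ring]
  exact v.map_sub_le (v.map_add_le (by rwa [hv]) hs.2) hs'

/-! ### The ramification break of an Artin-Schreier extension. -/

section ArtinSchreier

variable {p : ℕ} [CharP L p]

theorem Valuation.map_castHom_le_one [Fact p.Prime] (i : ZMod p) :
    v (ZMod.castHom dvd_rfl L i) ≤ 1 := by
  have hpow : v (ZMod.castHom (dvd_refl p) L i) ^ p = v (ZMod.castHom (dvd_refl p) L i) := by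
    rw [← map_pow, ← map_pow, ZMod.pow_card]
  by_contra! h
  exact (lt_self_pow₀ h (Fact.out : p.Prime).one_lt).ne' hpow

variable [Fact p.Prime] {χ : G →* Multiplicative (ZMod p)} {y : L}

open Polynomial in
/-- Elements fixed by the kernel of a character are polynomials of degree `< p` in a generator of
the corresponding Artin-Schreier extension, with coefficients in the fixed field. -/
theorem exists_polynomial_of_fixed_by_ker
    (hy : ∀ g : G, g • y = y + ZMod.castHom dvd_rfl L (χ g).toAdd)
    (hχ : Function.Surjective χ) {c : L} (hc : ∀ g : G, χ g = 1 → g • c = c) :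
    ∃ a : ℕ → L, (∀ j, ∀ g : G, g • a j = a j) ∧ c = ∑ j ∈ Finset.range p, a j * y ^ j := by
  choose s hs using fun i : ZMod p => hχ (Multiplicative.ofAdd i)
  let κ := ZMod.castHom (dvd_refl p) L
  have hκ : Function.Injective κ := κ.injective
  let node : ZMod p → L := fun i => y + κ i
  have hnode : Set.InjOn node (Finset.univ : Finset (ZMod p)) := fun i _ j _ h =>
    hκ (add_left_cancel h)
  -- Interpolation of the conjugates of `c` at the conjugates `y + i` of `y`. By uniqueness in
  -- degree `< p` the polynomial is invariant under `G`, so its coefficients are fixed; at `y` it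
  -- takes the value `c`.
  let P : L[X] := Lagrange.interpolate Finset.univ node fun i => s i • c
  have hdeg : P.degree < (Finset.univ : Finset (ZMod p)).card :=
    Lagrange.degree_interpolate_lt _ hnode
  have heval : ∀ i, P.eval (node i) = s i • c := fun i =>
    Lagrange.eval_interpolate_at_node _ hnode (Finset.mem_univ i)
  have hsmul : ∀ (g : G) (i : ZMod p), g • s i • c = s (i + (χ g).toAdd) • c := by
    intro g i
    have h1 : χ ((s (i + (χ g).toAdd))⁻¹ * (g * s i)) = 1 := by
      rw [map_mul, map_inv, map_mul, hs, hs, inv_mul_eq_one, ofAdd_add, mul_comm]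
      rfl
    have h2 := hc _ h1
    rw [mul_smul, inv_smul_eq_iff, mul_smul] at h2
    exact h2
  have hinv : ∀ g : G, P.map (MulSemiringAction.toRingHom G L g) = P := by
    intro g
    refine Polynomial.eq_of_degrees_lt_of_eval_index_eq Finset.univ hnode
      (degree_map_le.trans_lt hdeg) hdeg fun i _ => ?_
    have h1 : node i = g • node (i - (χ g).toAdd) := by
      change y + κ i = g • (y + κ (i - (χ g).toAdd))
      rw [smul_add, hy, smul_castHom, map_sub]
      ring
    have h2 : node i = MulSemiringAction.toRingHom G L g (node (i - (χ g).toAdd)) := h1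
    rw [h2, Polynomial.eval_map_apply, heval, ← h2, heval]
    change g • s (i - (χ g).toAdd) • c = _
    rw [hsmul, sub_add_cancel]
  refine ⟨P.coeff, fun j g => ?_, ?_⟩
  · conv_rhs => rw [← hinv g, coeff_map]
    rfl
  · have h1 : P.eval y = c := by
      have := heval 0
      simp only [node, map_zero, add_zero] at this
      rw [this]
      refine hc _ ?_
      rw [hs]; rfl
    rw [Finset.card_univ, ZMod.card] at hdeg
    rw [← h1]
    by_cases hP : P = 0
    · simp [hP]
    · exact eval_eq_sum_range' ((natDegree_lt_iff_degree_lt hP).mpr hdeg) y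

/-- In an Artin-Schreier extension whose generator has a pole of order `m`, prime to `p`, the
group acts trivially on integral elements to order `m + 1`. -/
theorem map_smul_sub_le_of_fixed_by_ker {e' m : ℕ} (he' : e' ≠ 0) (hm : ¬ p ∣ m)
    (hval : ∀ z : L, (∀ g : G, g • z = z) → z ≠ 0 → ∃ n : ℤ, v z = exp (n * (p * e' : ℕ)))
    (hy : ∀ g : G, g • y = y + ZMod.castHom dvd_rfl L (χ g).toAdd)
    (hχ : Function.Surjective χ) (hvy : v y = exp (m * e' : ℤ)) {c : L} (hc1 : v c ≤ 1)
    (hc : ∀ g : G, χ g = 1 → g • c = c) (g : G) :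
    v (g • c - c) ≤ exp (-(e' * (m + 1) : ℤ)) := by
  obtain ⟨a, ha, rfl⟩ := exists_polynomial_of_fixed_by_ker hy hχ hc
  have hp := (Fact.out : p.Prime)
  have hm0 : m ≠ 0 := by rintro rfl; exact hm (dvd_zero p)
  have hpos : 0 < (e' : ℤ) := by omega
  have hvt : ∀ j, v (a j * y ^ j) ≠ 0 → ∃ n : ℤ, v (a j * y ^ j) = exp (e' * (n * p + m * j)) := by
    intro j hj
    have ha0 : a j ≠ 0 := by rintro h; simp [h] at hj
    obtain ⟨n, hn⟩ := hval _ (ha j) ha0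
    refine ⟨n, ?_⟩
    rw [map_mul, map_pow, hn, hvy, ← exp_nsmul, ← exp_add, nsmul_eq_mul]
    congr 1
    push_cast
    ring
  have hterm : ∀ j ∈ Finset.range p, v (a j * y ^ j) ≤ 1 := by
    intro j hj
    refine (v.map_le_map_sum_of_injOn _ _ ?_ hj).trans hc1
    intro i hi j hj hi0 hij
    obtain ⟨n, hn⟩ := hvt i hi0
    obtain ⟨n', hn'⟩ := hvt j (hij ▸ hi0)
    rw [hn, hn', exp_inj] at hij
    have h1 := mul_left_cancel₀ hpos.ne' hij
    have h2 : (p : ℤ) ∣ m * ((i : ℤ) - j) := ⟨n' - n, by linarith⟩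
    rcases (Nat.prime_iff_prime_int.mp hp).dvd_or_dvd h2 with h3 | h3
    · exact absurd (Int.natCast_dvd_natCast.mp h3) hm
    · rw [Finset.mem_range] at hi hj
      have := Int.eq_zero_of_abs_lt_dvd h3 (by rw [abs_lt]; constructor <;> omega)
      omega
  rw [Finset.smul_sum, ← Finset.sum_sub_distrib]
  refine v.map_sum_le fun j hj => ?_
  rw [smul_mul', ha, smul_pow', ← mul_sub]
  rcases Nat.eq_zero_or_pos j with rfl | hj0
  · simp
  by_cases ha0 : v (a j * y ^ j) = 0
  · have : a j = 0 := by
      rw [v.zero_iff, mul_eq_zero] at ha0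
      refine ha0.resolve_right (pow_ne_zero _ ?_)
      rw [← v.ne_zero_iff, hvy]; exact exp_ne_zero
    simp [this]
  obtain ⟨n, hn⟩ := hvt j ha0
  have hle := hterm j hj
  rw [Finset.mem_range] at hj
  -- A term with `0 < j < p` is never a unit, since `p ∤ m * j`. This strictness is what gives `m +
  -- 1` rather than `m`.
  have hneg : n * p + m * j ≤ -1 := by
    rw [hn, ← exp_zero, exp_le_exp] at hle
    have h1 : n * p + m * j ≤ 0 := by
      by_contra! h
      nlinarith
    have h2 : n * p + m * j ≠ 0 := by
      intro h
      have h3 : p ∣ m * j := by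
        rw [← Int.natCast_dvd_natCast]
        exact ⟨-n, by push_cast; linarith⟩
      rcases hp.dvd_mul.mp h3 with h4 | h4
      · exact hm h4
      · exact absurd (Nat.le_of_dvd hj0 h4) (by omega)
    omega
  have hy1 : v (g • y) = exp (m * e' : ℤ) := by
    rw [hy]
    have hk : v (ZMod.castHom (dvd_refl p) L (χ g).toAdd) < v y := by
      refine (Valuation.map_castHom_le_one _).trans_lt ?_
      rw [hvy, ← exp_zero, exp_lt_exp]
      positivity
    rw [v.map_add_eq_of_lt_left hk, hvy]
  have hfac : (g • y) ^ j - y ^ j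
      = ZMod.castHom dvd_rfl L (χ g).toAdd *
          ∑ i ∈ Finset.range j, (g • y) ^ i * y ^ (j - 1 - i) := by
    rw [← Commute.geom_sum₂_mul (Commute.all _ _), mul_comm]
    congr 1
    rw [hy]; ring
  have hκ := Valuation.map_castHom_le_one (v := v) (χ g).toAdd
  have hsum : v (∑ i ∈ Finset.range j, (g • y) ^ i * y ^ (j - 1 - i))
      ≤ exp ((m * e' : ℤ) * (j - 1)) := by
    refine v.map_sum_le fun i hi => ?_
    rw [Finset.mem_range] at hi
    rw [map_mul, map_pow, map_pow, hy1, hvy, ← pow_add, ← exp_nsmul, exp_le_exp, nsmul_eq_mul]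
    rw [show i + (j - 1 - i) = j - 1 by omega, Nat.cast_sub (by omega)]
    push_cast
    linarith
  have haj : v (a j) = exp (e' * (n * p)) := by
    have h1 : v (a j) * v (y ^ j) = exp (e' * (n * p)) * v (y ^ j) := by
      rw [← map_mul, hn, map_pow, hvy, ← exp_nsmul, ← exp_add, nsmul_eq_mul]
      congr 1
      ring
    refine mul_right_cancel₀ ?_ h1
    rw [map_pow, hvy]
    exact pow_ne_zero _ exp_ne_zero
  rw [hfac, map_mul, map_mul, haj]
  calc exp (e' * (n * p)) * (_ * _)
      ≤ exp (e' * (n * p)) * (1 * exp ((m * e' : ℤ) * (j - 1))) :=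
        mul_le_mul_right (mul_le_mul' hκ hsum) _
    _ = exp (e' * (n * p + m * j) - m * e') := by
        rw [one_mul, ← exp_add]; congr 1; ring
    _ ≤ exp (-(e' * (m + 1) : ℤ)) := by
        rw [exp_le_exp]
        nlinarith

end ArtinSchreier

end Action

theorem WithZero.exp_sum {ι : Type*} (s : Finset ι) (f : ι → ℤ) :
    exp (∑ i ∈ s, f i) = ∏ i ∈ s, exp (f i) := by
  classical
  induction s using Finset.induction_on with
  | empty => simp
  | insert a s ha ih => rw [Finset.sum_insert ha, Finset.prod_insert ha, exp_add, ih]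

/-! ### Passing to the quotient by the kernel of a character. -/

section Action

variable {L G : Type*} [Field L] [Group G] [MulSemiringAction G L]
variable {v : Valuation L ℤᵐ⁰} {hv : ∀ (g : G) (x : L), v (g • x) = v x}
variable {p : ℕ} [Fact p.Prime]

theorem surjective_character_of_ne_one {G : Type*} [Group G] {χ : G →* Multiplicative (ZMod p)}
    {g : G} (hg : χ g ≠ 1) : Function.Surjective χ := by
  intro b
  refine ⟨g ^ (b.toAdd / (χ g).toAdd).val, Multiplicative.toAdd.injective ?_⟩
  have h0 : (χ g).toAdd ≠ 0 := hg
  rw [map_pow, toAdd_pow, nsmul_eq_mul, ZMod.natCast_zmod_val, div_mul_cancel₀ _ h0]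

/-- A nontrivial fibre of a character on a subgroup contains at most the `p`-th part of the
subgroup. -/
theorem mul_card_fiber_le [Finite G] (χ : G →* Multiplicative (ZMod p)) (H : Subgroup G) {τ : G}
    (hτ : χ τ ≠ 1) : p * Nat.card {h : χ.ker // τ * h ∈ H} ≤ Nat.card H := by
  rcases isEmpty_or_nonempty {h : χ.ker // τ * h ∈ H} with hE | ⟨⟨b, hb⟩⟩
  · simp
  have hp : Nat.card (ZMod p) = p := Nat.card_zmod p
  rw [← congrArg (· * _) hp, ← Nat.card_prod]
  -- From `(τ * b) ^ i * (τ * h)` the character recovers `i`, and cancellation recovers `h`; so `p`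
  -- copies of the fibre embed in `H`.
  refine Nat.card_le_card_of_injective (fun q : ZMod p × {h : χ.ker // τ * h ∈ H} =>
    (⟨(τ * b) ^ q.1.val * (τ * q.2.1), H.mul_mem (H.pow_mem hb _) q.2.2⟩ : H)) ?_
  rintro ⟨i, h⟩ ⟨i', h'⟩ heq
  have h1 : (τ * b) ^ i.val * (τ * (h.1 : G)) = (τ * b) ^ i'.val * (τ * (h'.1 : G)) :=
    congrArg Subtype.val heq
  have hker : ∀ k : χ.ker, χ k = 1 := fun k => k.2
  have h0 : (χ τ).toAdd ≠ 0 := hτ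
  have h2 : i = i' := by
    have := congrArg (fun z => (χ z).toAdd) h1
    simp only [map_mul, map_pow, hker, mul_one, toAdd_mul, toAdd_pow, nsmul_eq_mul,
      ZMod.natCast_zmod_val] at this
    exact mul_right_cancel₀ h0 (add_right_cancel this)
  subst h2
  have h3 : (h.1 : G) = h'.1 := mul_left_cancel (mul_left_cancel h1)
  rw [Subtype.ext (Subtype.ext h3)]

open Polynomial in
/-- The product of the differents of the elements of a coset of the kernel of a character. -/
theorem prod_map_smul_sub_le [Fintype G] [CharP L p] {χ : G →* Multiplicative (ZMod p)}
    (hv : ∀ (g : G) (x : L), v (g • x) = v x) {x : L} (hx : v x ≤ 1) {B : ℤᵐ⁰} (τ : G)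
    (hB : ∀ c : L, v c ≤ 1 → (∀ g : G, χ g = 1 → g • c = c) → v (τ • c - c) ≤ B) :
    ∏ h : χ.ker, v ((τ * h) • x - x) ≤ B := by
  classical
  -- The polynomial with roots the conjugates of `x` under `χ.ker` has integral coefficients fixed
  -- by `χ.ker`. It vanishes at `x`, so up to signs the product of the differences is the value at
  -- `x` of its `τ`-conjugate minus itself.
  let f₀ : v.integer[X] := ∏ h : χ.ker, (X - C ⟨(h : G) • x, by
    rw [Valuation.mem_integer_iff, hv]; exact hx⟩)
  let f : L[X] := f₀.map v.integer.subtype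
  have hf : f = ∏ h : χ.ker, (X - C ((h : G) • x)) := by
    simp only [f, f₀, Polynomial.map_prod, Polynomial.map_sub, map_X, map_C]
    rfl
  have hcoeff1 : ∀ i, v (f.coeff i) ≤ 1 := fun i => by
    rw [coeff_map]; exact (f₀.coeff i).2
  have hmap : ∀ g : G, f.map (MulSemiringAction.toRingHom G L g)
      = ∏ h : χ.ker, (X - C ((g * h) • x)) := by
    intro g
    rw [hf, Polynomial.map_prod]
    refine Finset.prod_congr rfl fun h _ => ?_
    rw [Polynomial.map_sub, map_X, map_C, MulSemiringAction.toRingHom_apply, smul_smul]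
  have hcoeff2 : ∀ i, ∀ g : G, χ g = 1 → g • f.coeff i = f.coeff i := by
    intro i g hg
    have : f.map (MulSemiringAction.toRingHom G L g) = f := by
      rw [hmap, hf]
      exact Fintype.prod_equiv (Equiv.mulLeft (⟨g, hg⟩ : χ.ker)) _ _ fun _ => rfl
    conv_rhs => rw [← this, coeff_map]
    rfl
  have h0 : f.eval x = 0 := by
    rw [hf, eval_prod]
    exact Finset.prod_eq_zero (Finset.mem_univ 1) (by simp)
  have h1 : ∏ h : χ.ker, v ((τ * h) • x - x)
      = v ((f.map (MulSemiringAction.toRingHom G L τ) - f).eval x) := by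
    rw [eval_sub, h0, sub_zero, hmap, eval_prod, map_prod]
    refine Finset.prod_congr rfl fun h _ => ?_
    rw [eval_sub, eval_X, eval_C, v.map_sub_swap]
  rw [h1, eval_eq_sum_range]
  refine v.map_sum_le fun i _ => ?_
  rw [map_mul, map_pow, coeff_sub, coeff_map]
  exact mul_le_of_le_of_le_one (hB _ (hcoeff1 i) (hcoeff2 i)) (pow_le_one' hx _)

/-- If the ramification filtration can be read off an integral element `x`, a character given by an
Artin-Schreier generator with a pole of order `m`, prime to `p`, has conductor at least `m`. -/
theorem exists_ramification_break [Finite G] [FaithfulSMul G L] [CharP L p] {x : L} (hx : v x ≤ 1)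
    (hgen : ∀ (g : G) (i : ℕ), v (g • x - x) ≤ exp (-((i : ℤ) + 1)) →
      g ∈ isometryRamificationGroup v hv i)
    {e' m : ℕ} (he' : e' ≠ 0) (hm : ¬ p ∣ m)
    (hcard : Nat.card (isometryRamificationGroup v hv 0) ≤ p * e')
    (hval : ∀ z : L, (∀ g : G, g • z = z) → z ≠ 0 → ∃ n : ℤ, v z = exp (n * (p * e' : ℕ)))
    {χ : G →* Multiplicative (ZMod p)} {y : L}
    (hy : ∀ g : G, g • y = y + ZMod.castHom dvd_rfl L (χ g).toAdd)
    (hvy : v y = exp (m * e' : ℤ)) :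
    ∃ s : ℕ, isometryRamificationGroup v hv s ≠ ⊥ ∧
      Nat.card (isometryRamificationGroup v hv 0) * (m + 1) ≤
        ∑ i ∈ Finset.range (s + 1), Nat.card (isometryRamificationGroup v hv i) := by
  classical
  have := Fintype.ofFinite G
  set R := isometryRamificationGroup v hv with hR
  have hp := (Fact.out : p.Prime)
  have hy0 : y ≠ 0 := by rw [← v.ne_zero_iff, hvy]; exact exp_ne_zero
  -- For trivial `χ` the element `y` would be fixed, and `hval` would make `m` divisible by `p`.
  obtain ⟨τ, hτ⟩ : ∃ τ, χ τ ≠ 1 := by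
    by_contra! h
    obtain ⟨n, hn⟩ := hval y (fun g => by rw [hy, h]; simp) hy0
    rw [hvy, exp_inj] at hn
    have : (m : ℤ) = p * n := by
      refine mul_right_cancel₀ (b := (e' : ℤ)) (by omega) ?_
      rw [hn]; push_cast; ring
    exact hm (Int.natCast_dvd_natCast.mp ⟨n, this⟩)
  have hχ := surjective_character_of_ne_one hτ
  have hprod := prod_map_smul_sub_le hv hx τ fun c hc hc' =>
    map_smul_sub_le_of_fixed_by_ker he' hm hval hy hχ hvy hc hc' τ
  -- `d h` is Serre's i_G(τh): it counts the groups `R i` containing `τ * h`. With it `hprod`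
  -- becomes `e' * (m + 1) ≤ ∑ d h`, the half of Herbrand's theorem that is needed.
  let d : χ.ker → ℕ := fun h => (-log (v ((τ * h) • x - x))).toNat
  have hle1 : ∀ g : G, v (g • x - x) ≤ 1 := fun g => v.map_sub_le (by rwa [hv]) hx
  have hne : ∀ h : χ.ker, v ((τ * h) • x - x) ≠ 0 := by
    intro h h0
    have h1 : τ * h = 1 := by
      refine eq_of_smul_eq_smul (α := L) fun c => ?_
      rw [one_smul]
      have hall : ∀ i : ℕ, τ * h ∈ R i := fun i => hgen _ i (by rw [h0]; exact zero_le)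
      have hint : ∀ c : L, v c ≤ 1 → (τ * h : G) • c = c := by
        intro c hc
        by_contra hne
        have h2 : v ((τ * h : G) • c - c) ≠ 0 := (v.ne_zero_iff).mpr (sub_ne_zero.mpr hne)
        have h3 := hall (-log (v ((τ * h : G) • c - c))).toNat c hc
        rw [← exp_log h2, exp_le_exp, log_exp] at h3
        omega
      rcases le_total (v c) 1 with hc | hc
      · exact hint c hc
      · have := hint c⁻¹ (by rw [map_inv₀]; exact inv_le_one_of_one_le₀ hc)
        rw [smul_inv''] at this
        exact inv_injective this
    have h2 : χ (τ * h) = χ τ := by rw [map_mul, show χ h = 1 from h.2, mul_one]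
    rw [h1, map_one] at h2
    exact hτ h2.symm
  have hvd : ∀ h : χ.ker, v ((τ * h) • x - x) = exp (-(d h : ℤ)) := by
    intro h
    have h1 := hle1 (τ * h)
    rw [← exp_log (hne h), ← exp_zero, exp_le_exp] at h1
    rw [← exp_log (hne h), exp_inj]
    simp only [d]
    omega
  have hmem : ∀ (h : χ.ker) (i : ℕ), τ * h ∈ R i ↔ i < d h := by
    intro h i
    constructor
    · intro hi
      have := hi x hx
      rw [hvd, exp_le_exp] at this
      omega
    · intro hi
      refine hgen _ i ?_
      rw [hvd, exp_le_exp]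
      omega
  have hsumd : e' * (m + 1) ≤ ∑ h : χ.ker, d h := by
    rw [Finset.prod_congr rfl fun h _ => hvd h, ← WithZero.exp_sum, exp_le_exp,
      Finset.sum_neg_distrib,
      neg_le_neg_iff] at hprod
    exact_mod_cast hprod
  let M := ∑ h : χ.ker, d h
  have hdM : ∀ h, d h ≤ M := fun h => Finset.single_le_sum (fun _ _ => Nat.zero_le _)
    (Finset.mem_univ h)
  have hdouble : ∑ h : χ.ker, d h
      = ∑ i ∈ Finset.range M, Nat.card {h : χ.ker // τ * h ∈ R i} := by
    have h1 : ∀ h : χ.ker, d h = ∑ i ∈ Finset.range M, if i < d h then 1 else 0 := by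
      intro h
      rw [Finset.sum_boole, Nat.cast_id]
      have : (Finset.range M).filter (fun i => i < d h) = Finset.range (d h) := by
        ext i
        have := hdM h
        simp only [Finset.mem_filter, Finset.mem_range]
        omega
      rw [this, Finset.card_range]
    rw [Finset.sum_congr rfl fun h _ => h1 h, Finset.sum_comm]
    refine Finset.sum_congr rfl fun i _ => ?_
    rw [Finset.sum_boole, Nat.cast_id, Nat.card_eq_fintype_card, Fintype.card_subtype]
    simp only [hmem]
  obtain ⟨h₀, hh₀⟩ : ∃ h, 0 < d h := by
    by_contra! h
    have : ∑ h : χ.ker, d h = 0 := Finset.sum_eq_zero fun k _ => Nat.le_zero.mp (h k)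
    rw [this] at hsumd
    have := Nat.pos_of_ne_zero he'
    nlinarith
  obtain ⟨h₁, -, hmax⟩ := Finset.univ.exists_max_image d ⟨h₀, Finset.mem_univ _⟩
  have hd1 : 0 < d h₁ := hh₀.trans_le (hmax h₀ (Finset.mem_univ _))
  -- The index of the last ramification group meeting the coset `τ * χ.ker`; that group is
  -- nontrivial since `1` is not in the coset.
  refine ⟨d h₁ - 1, ?_, ?_⟩
  · intro hbot
    have h1 := (hmem h₁ (d h₁ - 1)).mpr (by omega)
    rw [hbot, Subgroup.mem_bot] at h1
    have h2 : χ (τ * h₁) = χ τ := by rw [map_mul, show χ h₁ = 1 from h₁.2, mul_one]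
    rw [h1, map_one] at h2
    exact hτ h2.symm
  · rw [Nat.sub_add_cancel hd1]
    calc Nat.card (R 0) * (m + 1) ≤ p * e' * (m + 1) := Nat.mul_le_mul_right _ hcard
      _ ≤ p * ∑ h : χ.ker, d h := by rw [mul_assoc]; exact Nat.mul_le_mul_left _ hsumd
      _ = ∑ i ∈ Finset.range M, p * Nat.card {h : χ.ker // τ * h ∈ R i} := by
        rw [hdouble, Finset.mul_sum]
      _ = ∑ i ∈ Finset.range (d h₁), p * Nat.card {h : χ.ker // τ * h ∈ R i} := by
        refine (Finset.sum_subset (fun i hi => ?_) fun i _ hi => ?_).symm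
        · rw [Finset.mem_range] at hi ⊢
          exact hi.trans_le (hdM h₁)
        · rw [Finset.mem_range, not_lt] at hi
          have : IsEmpty {h : χ.ker // τ * h ∈ R i} := ⟨fun h => by
            have h1 := (hmem h.1 i).mp h.2
            have h2 := hmax h.1 (Finset.mem_univ _)
            omega⟩
          simp
      _ ≤ ∑ i ∈ Finset.range (d h₁), Nat.card (R i) :=
        Finset.sum_le_sum fun i _ => mul_card_fiber_le χ (R i) hτ

end Action

/-! ### Counting characters by the pole order of their Artin-Schreier generators. -/

section Action

variable {L G : Type*} [Field L] [Group G] [MulSemiringAction G L]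
variable {v : Valuation L ℤᵐ⁰} {hv : ∀ (g : G) (x : L), v (g • x) = v x}
variable {p : ℕ} [CharP L p]

variable (v) in
/-- The character `χ` is given by an Artin-Schreier generator whose pole has order at most `m`,
the fixed field having ramification index `e`. -/
def HasPoleOrderLE (e m : ℕ) (χ : G →* Multiplicative (ZMod p)) : Prop :=
  ∃ y : L, (∀ g : G, g • y = y + ZMod.castHom dvd_rfl L (χ g).toAdd) ∧
    v (y ^ p - y) ≤ exp ((m : ℤ) * e)

variable [Fact p.Prime]

theorem smul_artinSchreier {χ : G →* Multiplicative (ZMod p)} {y : L}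
    (hy : ∀ g : G, g • y = y + ZMod.castHom dvd_rfl L (χ g).toAdd) (g : G) :
    g • (y ^ p - y) = y ^ p - y := by
  rw [smul_sub, smul_pow', hy, add_pow_char, ← map_pow, ZMod.pow_card]
  ring

theorem smul_sub_eq_add_character_div {χ χ' : G →* Multiplicative (ZMod p)} {y y' : L}
    (hy : ∀ g : G, g • y = y + ZMod.castHom dvd_rfl L (χ g).toAdd)
    (hy' : ∀ g : G, g • y' = y' + ZMod.castHom dvd_rfl L (χ' g).toAdd) (g : G) :
    g • (y - y') = y - y' + ZMod.castHom dvd_rfl L ((χ / χ') g).toAdd := by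
  rw [smul_sub, hy, hy', MonoidHom.div_apply, toAdd_div, map_sub]
  ring

/-- The poles of the Artin-Schreier generators of all characters are bounded in terms of the
ramification filtration. -/
theorem hasPoleOrderLE_of_ramification [Finite G] [FaithfulSMul G L] {r : ℕ} (hr : r ≠ 0)
    (hN : ∀ c, v c ≤ 1 → v (c ^ p ^ r - c) < 1) {π : L} (hπ : v π = exp (-1 : ℤ))
    {ξ : L} (hξ : v ξ ≤ 1) (hgen : ∀ c, v c ≤ 1 → v c < 1 ∨ ∃ n : ℕ, v (c - ξ ^ n) < 1)
    {ν : ℕ} (hν : ∀ s m : ℕ, isometryRamificationGroup v hv s ≠ ⊥ →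
      Nat.card (isometryRamificationGroup v hv 0) * (m + 1) ≤
        ∑ i ∈ Finset.range (s + 1), Nat.card (isometryRamificationGroup v hv i) → m < ν)
    {e : ℕ} {ϖ : L} (he : e ≠ 0) (hϖ : v ϖ = exp (-(e : ℤ))) (hfix : ∀ g : G, g • ϖ = ϖ)
    (hval : ∀ z : L, (∀ g : G, g • z = z) → z ≠ 0 → ∃ n : ℤ, v z = exp (n * e))
    (χ : G →* Multiplicative (ZMod p)) : HasPoleOrderLE v e (ν - 1) χ := by
  classical
  have hp := (Fact.out : p.Prime)
  have hepos : 0 < (e : ℤ) := by omega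
  have hϖ0 : ϖ ≠ 0 := by rw [← v.ne_zero_iff, hϖ]; exact exp_ne_zero
  have mono : ∀ m n : ℕ, m ≤ n → HasPoleOrderLE v e m χ → HasPoleOrderLE v e n χ := by
    rintro m n hmn ⟨y, hy, hle⟩
    refine ⟨y, hy, hle.trans (exp_le_exp.mpr ?_)⟩
    exact mul_le_mul_of_nonneg_right (by exact_mod_cast hmn) hepos.le
  have hex : ∃ n, HasPoleOrderLE v e n χ := by
    obtain ⟨y, hy⟩ := exists_smul_eq_add_character (L := L) p χ
    obtain ⟨M, hM⟩ := WithZero.exists_nat_le_exp fun _ : Unit => v (y ^ p - y)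
    refine ⟨M, y, hy, (hM ()).trans (exp_le_exp.mpr ?_)⟩
    exact le_mul_of_one_le_right (by omega) (by omega)
  refine mono _ _ ?_ (Nat.find_spec hex)
  obtain ⟨y, hy, hle⟩ := Nat.find_spec hex
  have hmin : ∀ m, m < Nat.find hex → ¬ HasPoleOrderLE v e m χ := fun m hm => Nat.find_min hex hm
  generalize Nat.find hex = n at *
  rcases Nat.eq_zero_or_pos n with rfl | hn
  · exact Nat.zero_le _
  have hafix := smul_artinSchreier hy
  have hva : v (y ^ p - y) = exp ((n : ℤ) * e) := by
    by_cases h0 : y ^ p - y = 0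
    · exact absurd ⟨y, hy, by rw [h0, map_zero]; exact zero_le⟩ (hmin 0 hn)
    obtain ⟨k, hk⟩ := hval _ hafix h0
    rw [hk] at hle ⊢
    have h1 : k ≤ n := le_of_mul_le_mul_right (exp_le_exp.mp hle) hepos
    have h2 : ¬ k ≤ (n - 1 : ℕ) := fun h => hmin (n - 1) (by omega) ⟨y, hy, by
      rw [hk, exp_le_exp]; exact mul_le_mul_of_nonneg_right h hepos.le⟩
    rw [show k = n by omega]
  by_cases hpn : p ∣ n
  -- If `p ∣ n`, the leading coefficient `c` is congruent to a `p`-th power `d ^ p`, because the `p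
  -- ^ r`-th power map is trivial on residues. Subtracting `d * (ϖ ^ n')⁻¹` from `y` removes the
  -- leading term, and the new linear term has pole order `n' ≤ p * n' - 1`, against minimality.
  · exfalso
    obtain ⟨n', rfl⟩ := hpn
    have hn' : 0 < n' := Nat.pos_of_mul_pos_left hn
    set a := y ^ p - y with ha
    set c := a * ϖ ^ (p * n') with hc
    have hvc : v c = 1 := by
      rw [hc, map_mul, map_pow, hva, hϖ, ← exp_nsmul, ← exp_add, ← exp_zero, exp_inj, nsmul_eq_mul]
      ring
    have hcfix : ∀ g : G, g • c = c := fun g => by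
      rw [hc, smul_mul', smul_pow', hfix, hafix]
    set d := c ^ p ^ (r - 1) with hd
    have hdfix : ∀ g : G, g • d = d := fun g => by rw [hd, smul_pow', hcfix]
    have hdp : d ^ p = c ^ p ^ r := by
      rw [hd, ← pow_mul, ← pow_succ, Nat.sub_add_cancel (Nat.pos_of_ne_zero hr)]
    have hvd : v d = 1 := by rw [hd, map_pow, hvc, one_pow]
    have hz : v (c - d ^ p) ≤ exp (-(e : ℤ)) := by
      by_cases h0 : c - d ^ p = 0
      · rw [h0, map_zero]; exact zero_le
      obtain ⟨k, hk⟩ := hval _ (fun g => by rw [smul_sub, smul_pow', hcfix, hdfix]) h0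
      have h1 : v (c - d ^ p) < 1 := by rw [v.map_sub_swap, hdp]; exact hN c hvc.le
      rw [hk, ← exp_zero, exp_lt_exp] at h1
      rw [hk, exp_le_exp]
      have : k < 0 := by by_contra! h; nlinarith
      nlinarith
    clear_value d
    refine hmin (p * n' - 1) (by omega) ⟨y - d * (ϖ ^ n')⁻¹, fun g => ?_, ?_⟩
    · rw [smul_sub, hy, smul_mul', smul_inv'', smul_pow', hfix, hdfix]
      ring
    · have h1 : (y - d * (ϖ ^ n')⁻¹) ^ p - (y - d * (ϖ ^ n')⁻¹)
          = (c - d ^ p) * (ϖ ^ (p * n'))⁻¹ + d * (ϖ ^ n')⁻¹ := by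
        rw [sub_pow_char, mul_pow, inv_pow, ← pow_mul, mul_comm n' p, hc, sub_mul,
          mul_inv_cancel_right₀ (pow_ne_zero _ hϖ0), ha]
        ring
      have hinv : ∀ k : ℕ, v (ϖ ^ k)⁻¹ = exp ((k : ℤ) * e) := fun k => by
        rw [map_inv₀, map_pow, hϖ, ← exp_nsmul, ← exp_neg, nsmul_eq_mul]
        congr 1; ring
      have h2 : (2 : ℤ) ≤ p := by exact_mod_cast hp.two_le
      have h3 : ((p * n' - 1 : ℕ) : ℤ) = p * n' - 1 := by
        rw [Nat.cast_sub (by omega)]; push_cast; ring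
      have h4 : (1 : ℤ) ≤ n' := by exact_mod_cast hn'
      rw [h1, h3]
      refine v.map_add_le ?_ ?_
      · rw [map_mul, hinv]
        calc v (c - d ^ p) * _ ≤ exp (-(e : ℤ)) * exp (((p * n' : ℕ) : ℤ) * e) :=
              mul_le_mul_left hz _
          _ = exp (((p : ℤ) * n' - 1) * e) := by
            rw [← exp_add]; congr 1; push_cast; ring
      · rw [map_mul, hvd, one_mul, hinv, exp_le_exp]
        refine mul_le_mul_of_nonneg_right ?_ hepos.le
        nlinarith
  · have hgt : 1 < v (y ^ p - y) := by
      rw [hva, ← exp_zero, exp_lt_exp]; positivity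
    have hy1 : 1 < v y := by
      by_contra! h
      exact hgt.not_ge (v.map_sub_le (by rw [map_pow]; exact pow_le_one' h _) h)
    have hyp : v (y ^ p - y) = v y ^ p := by
      rw [v.map_sub_eq_of_lt_left, map_pow]
      rw [map_pow]
      exact lt_self_pow₀ hy1 hp.one_lt
    have hy0 : v y ≠ 0 := (zero_lt_one.trans hy1).ne'
    -- The pole of `y ^ p - y` comes from `y ^ p`. Since `p ∤ n`, this forces `p ∣ e`.
    have hlog : (p : ℤ) * log (v y) = n * e := by
      rw [hva, ← exp_log hy0, ← exp_nsmul, exp_inj, nsmul_eq_mul] at hyp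
      exact hyp.symm
    obtain ⟨e', rfl⟩ : p ∣ e := by
      have h1 : (p : ℤ) ∣ (n * e : ℕ) := ⟨_, by push_cast; exact hlog.symm⟩
      exact (hp.dvd_mul.mp (Int.natCast_dvd_natCast.mp h1)).resolve_left hpn
    have he' : e' ≠ 0 := by rintro rfl; simp at he
    have hvy : v y = exp ((n : ℤ) * e') := by
      rw [← exp_log hy0, exp_inj]
      refine mul_left_cancel₀ (a := (p : ℤ)) (by exact_mod_cast hp.ne_zero) ?_
      rw [hlog]; push_cast; ring
    obtain ⟨x, hx, hxgen⟩ := exists_ramification_generator hr hv hN hπ hξ hgen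
    obtain ⟨s, hs, hs'⟩ := exists_ramification_break hx hxgen he' hpn
      (card_inertia_le hv hr hN he hπ hϖ hfix) hval hy hvy
    have := hν s n hs hs'
    omega

/-- There are at most `p` characters with an integral Artin-Schreier generator, if the group is
generated by inertia and one element. -/
theorem card_hasPoleOrderLE_zero [Finite G] {e : ℕ} {φ : G}
    (hφ : ∀ g : G, ∃ n : ℕ, ∀ c, v c ≤ 1 → v (g • c - φ ^ n • c) < 1) :
    Nat.card {χ : G →* Multiplicative (ZMod p) // HasPoleOrderLE v e 0 χ} ≤ p := by
  have hp := (Fact.out : p.Prime)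
  conv_rhs => rw [← Nat.card_zmod p]
  refine Nat.card_le_card_of_injective
    (fun χ : {χ : G →* Multiplicative (ZMod p) // HasPoleOrderLE v e 0 χ} => (χ.1 φ).toAdd) ?_
  -- An integral generator `y` gives `g • y - φ ^ n • y` equal to χ(g) - χ(φ ^ n). This lies in the
  -- prime field, where only zero has value below 1.
  have key : ∀ χ : {χ : G →* Multiplicative (ZMod p) // HasPoleOrderLE v e 0 χ}, ∀ g n,
      (∀ c, v c ≤ 1 → v (g • c - φ ^ n • c) < 1) → χ.1 g = χ.1 φ ^ n := by
    rintro ⟨χ, y, hy, hle⟩ g n h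
    have hy1 : v y ≤ 1 := by
      by_contra! hgt
      have h1 : v (y ^ p - y) = v y ^ p := by
        rw [v.map_sub_eq_of_lt_left, map_pow]
        rw [map_pow]
        exact lt_self_pow₀ hgt hp.one_lt
      rw [h1, Nat.cast_zero, zero_mul, exp_zero] at hle
      exact hle.not_gt (one_lt_pow₀ hgt hp.ne_zero)
    have h1 := h y hy1
    rw [hy, hy, add_sub_add_left_eq_sub, ← map_sub] at h1
    rw [← map_pow]
    by_contra hne
    have h2 : (χ g).toAdd - (χ (φ ^ n)).toAdd ≠ 0 := sub_ne_zero.mpr hne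
    have h3 := Valuation.map_castHom_le_one (v := v)
      ((χ g).toAdd - (χ (φ ^ n)).toAdd)⁻¹
    rw [map_inv₀, map_inv₀] at h3
    refine h1.not_ge ?_
    have h4 : v (ZMod.castHom dvd_rfl L ((χ g).toAdd - (χ (φ ^ n)).toAdd)) ≠ 0 :=
      (v.ne_zero_iff).mpr ((map_ne_zero _).mpr h2)
    exact (inv_le_one₀ (zero_lt_iff.mpr h4)).mp h3
  intro χ χ' h
  refine Subtype.ext (MonoidHom.ext fun g => ?_)
  obtain ⟨n, hn⟩ := hφ g
  rw [key χ g n hn, key χ' g n hn, show χ.1 φ = χ'.1 φ from h]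

/-- Increasing the order of the pole multiplies the number of characters at most by the order of
the residue field of the fixed field. -/
theorem card_hasPoleOrderLE_succ [Finite G] {S : Type*} [Finite S] {res : L → S}
    (hres : ∀ c c' : L, (∀ g : G, g • c = c) → (∀ g : G, g • c' = c') → v c ≤ 1 → v c' ≤ 1 →
      res c = res c' → v (c - c') < 1)
    {e : ℕ} {ϖ : L} (he : e ≠ 0) (hϖ : v ϖ = exp (-(e : ℤ))) (hfix : ∀ g : G, g • ϖ = ϖ)
    (hval : ∀ z : L, (∀ g : G, g • z = z) → z ≠ 0 → ∃ n : ℤ, v z = exp (n * e)) (m : ℕ) :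
    Nat.card {χ : G →* Multiplicative (ZMod p) // HasPoleOrderLE v e (m + 1) χ} ≤
      Nat.card S * Nat.card {χ : G →* Multiplicative (ZMod p) // HasPoleOrderLE v e m χ} := by
  classical
  have hepos : 0 < (e : ℤ) := by omega
  have hϖ0 : v ϖ ≠ 0 := by rw [hϖ]; exact exp_ne_zero
  let X := {χ : G →* Multiplicative (ZMod p) // HasPoleOrderLE v e (m + 1) χ}
  have : Finite (G →* Multiplicative (ZMod p)) := DFunLike.finite _
  choose y hy hle using fun χ : X => χ.2
  let c : X → L := fun χ => (y χ ^ p - y χ) * ϖ ^ (m + 1)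
  have hpow : v (ϖ ^ (m + 1)) = exp (-(((m + 1 : ℕ) : ℤ) * e)) := by
    rw [map_pow, hϖ, ← exp_nsmul, nsmul_eq_mul]; congr 1; ring
  have hc1 : ∀ χ, v (c χ) ≤ 1 := fun χ => by
    rw [map_mul, hpow]
    calc _ ≤ exp (((m + 1 : ℕ) : ℤ) * e) * exp (-(((m + 1 : ℕ) : ℤ) * e)) :=
          mul_le_mul_left (hle χ) _
      _ = 1 := by rw [← exp_add, add_neg_cancel, exp_zero]
  have hcfix : ∀ χ, ∀ g : G, g • c χ = c χ := fun χ g => by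
    rw [smul_mul', smul_pow', hfix, smul_artinSchreier (hy χ)]
  have hdiv : ∀ χ χ' : X, res (c χ) = res (c χ') → HasPoleOrderLE v e m (χ.1 / χ'.1) := by
    intro χ χ' h
    refine ⟨y χ - y χ', smul_sub_eq_add_character_div (hy χ) (hy χ'), ?_⟩
    have h1 := hres _ _ (hcfix χ) (hcfix χ') (hc1 χ) (hc1 χ') h
    have h2 : (y χ - y χ') ^ p - (y χ - y χ') = (y χ ^ p - y χ) - (y χ' ^ p - y χ') := by
      rw [sub_pow_char]; ring
    rw [← sub_mul, map_mul, hpow] at h1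
    rw [h2]
    by_cases h0 : (y χ ^ p - y χ) - (y χ' ^ p - y χ') = 0
    · rw [h0, map_zero]; exact zero_le
    obtain ⟨k, hk⟩ := hval _ (fun g => by
      rw [smul_sub, smul_artinSchreier (hy χ), smul_artinSchreier (hy χ')]) h0
    rw [hk, ← exp_add, ← exp_zero, exp_lt_exp] at h1
    rw [hk, exp_le_exp]
    refine mul_le_mul_of_nonneg_right ?_ hepos.le
    by_contra! h
    push_cast at h1
    nlinarith
  -- One reference character for each residue of a leading coefficient that occurs. Dividing by it
  -- cancels the leading terms, which lowers the pole order.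
  let rep : S → (G →* Multiplicative (ZMod p)) := fun t =>
    if h : ∃ χ : X, res (c χ) = t then h.choose.1 else 1
  have hrep : ∀ χ : X, HasPoleOrderLE v e m (χ.1 / rep (res (c χ))) := by
    intro χ
    have h : ∃ χ' : X, res (c χ') = res (c χ) := ⟨χ, rfl⟩
    simp only [rep, dif_pos h]
    exact hdiv χ _ h.choose_spec.symm
  rw [← Nat.card_prod]
  refine Nat.card_le_card_of_injective (fun χ : X => (res (c χ), (⟨_, hrep χ⟩ :
    {χ : G →* Multiplicative (ZMod p) // HasPoleOrderLE v e m χ}))) ?_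
  intro χ χ' h
  have h1 := congrArg Prod.fst h
  have h2 := congrArg (fun q => q.2.1) h
  simp only at h1 h2
  rw [h1] at h2
  exact Subtype.ext (div_left_injective h2)

/-- A bound for the number of characters of order `p` of a group of isometries of a discretely
valued field of characteristic `p`, in terms of the ramification filtration and of the residue
field of the fixed field. -/
theorem card_characters_le [Finite G] [FaithfulSMul G L] {r : ℕ} (hr : r ≠ 0)
    (hN : ∀ c, v c ≤ 1 → v (c ^ p ^ r - c) < 1) {π : L} (hπ : v π = exp (-1 : ℤ))
    {ξ : L} (hξ : v ξ ≤ 1) (hgen : ∀ c, v c ≤ 1 → v c < 1 ∨ ∃ n : ℕ, v (c - ξ ^ n) < 1)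
    {φ : G} (hφ : ∀ g : G, ∃ n : ℕ, ∀ c, v c ≤ 1 → v (g • c - φ ^ n • c) < 1)
    {S : Type*} [Finite S] {res : L → S}
    (hres : ∀ c c' : L, (∀ g : G, g • c = c) → (∀ g : G, g • c' = c') → v c ≤ 1 → v c' ≤ 1 →
      res c = res c' → v (c - c') < 1)
    {ν : ℕ} (hν : ∀ s m : ℕ, isometryRamificationGroup v hv s ≠ ⊥ →
      Nat.card (isometryRamificationGroup v hv 0) * (m + 1) ≤
        ∑ i ∈ Finset.range (s + 1), Nat.card (isometryRamificationGroup v hv i) → m < ν) :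
    Nat.card (G →* Multiplicative (ZMod p)) ≤ p * Nat.card S ^ (ν - 1) := by
  obtain ⟨e, ϖ, he, hϖ, hfix, hval⟩ := exists_fixed_uniformizer G hv hπ
  have h1 : ∀ m, Nat.card {χ : G →* Multiplicative (ZMod p) // HasPoleOrderLE v e m χ} ≤
      p * Nat.card S ^ m := by
    intro m
    induction m with
    | zero => simpa using card_hasPoleOrderLE_zero hφ
    | succ m ih =>
      refine (card_hasPoleOrderLE_succ hres he hϖ hfix hval m).trans ?_
      rw [pow_succ, ← mul_assoc, mul_comm _ (Nat.card S)]
      exact Nat.mul_le_mul_left _ ih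
  refine le_trans (le_of_eq ?_) (h1 (ν - 1))
  exact (Nat.card_congr (Equiv.subtypeUnivEquiv fun χ =>
    hasPoleOrderLE_of_ramification hr hN hπ hξ hgen hν he hϖ hfix hval χ)).symm

end Action

/-! ### Places of function fields are discrete with finite residue fields -/

section Place

variable {F L : Type*} [Field F] [Finite F] [Field L] [Algebra F L]

theorem valuation_algebraMap_eq_one (P : ValuationSubring L) {b : F} (hb : b ≠ 0) :
    P.valuation (algebraMap F L b) = 1 := by
  refine le_antisymm ((P.valuation_le_one_iff _).mpr (algebraMap_mem_valuationSubring F P b)) ?_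
  have h := (P.valuation_le_one_iff _).mpr (algebraMap_mem_valuationSubring F P b⁻¹)
  rw [map_inv₀, map_inv₀] at h
  exact (inv_le_one₀ (zero_lt_iff.mpr (by simpa using hb))).mp h

open Polynomial in
theorem aeval_mem_valuationSubring (P : ValuationSubring L) {s : L} (hs : s ∈ P) (r : F[X]) :
    aeval s r ∈ P := by
  rw [aeval_eq_sum_range]
  refine sum_mem fun i _ => ?_
  rw [Algebra.smul_def]
  exact P.mul_mem _ _ (algebraMap_mem_valuationSubring F P _) (pow_mem hs i)

open Polynomial in
-- Once the largest power of `X` is taken out, the constant term is nonzero and the other terms are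
-- multiples of `s`.
theorem exists_aeval_eq_pow_mul (P : ValuationSubring L) {s : L} (hs : P.valuation s < 1)
    {r : F[X]} (hr : r ≠ 0) : ∃ (i : ℕ) (u : L) (b : F), aeval s r = s ^ i * u ∧ b ≠ 0 ∧
      P.valuation (u - algebraMap F L b) < 1 := by
  obtain ⟨q, hq, hdvd⟩ := exists_eq_pow_rootMultiplicity_mul_and_not_dvd r hr 0
  rw [C_0, sub_zero] at hq hdvd
  refine ⟨r.rootMultiplicity 0, aeval s q, q.coeff 0, ?_, fun h => hdvd (X_dvd_iff.mpr h), ?_⟩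
  · conv_lhs => rw [hq]
    rw [map_mul, map_pow, aeval_X]
  · have : aeval s q - algebraMap F L (q.coeff 0) = aeval s q.divX * s := by
      conv_lhs => rw [← divX_mul_X_add q]
      simp
    rw [this, map_mul, mul_comm]
    exact mul_lt_of_lt_of_le_one hs ((P.valuation_le_one_iff _).mpr
      (aeval_mem_valuationSubring P ((P.valuation_le_one_iff _).mp hs.le) _))

open IntermediateField in
/-- The place of a rational function field `F(s)` at which `s` vanishes. -/
theorem exists_eq_zpow_mul_of_mem_adjoin (P : ValuationSubring L) {s : L}
    (hs : P.valuation s < 1) {z : L} (hz : z ∈ F⟮s⟯) (hz0 : z ≠ 0) :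
    ∃ (k : ℤ) (u : L) (b : F), z = s ^ k * u ∧ b ≠ 0 ∧
      P.valuation (u - algebraMap F L b) < 1 ∧ P.valuation u = 1 := by
  obtain ⟨r, q, rfl⟩ := (mem_adjoin_simple_iff F z).mp hz
  have hr : r ≠ 0 := by rintro rfl; simp at hz0
  have hq : q ≠ 0 := by rintro rfl; simp at hz0
  have unit : ∀ (u : L) (b : F), b ≠ 0 → P.valuation (u - algebraMap F L b) < 1 →
      P.valuation u = 1 := by
    intro u b hb h
    have h1 := valuation_algebraMap_eq_one (F := F) P hb
    rw [← h1] at h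
    rw [← h1, show u = (u - algebraMap F L b) + algebraMap F L b by ring]
    exact P.valuation.map_add_eq_of_lt_right h
  obtain ⟨i, u, b, h1, hb, hu⟩ := exists_aeval_eq_pow_mul P hs hr
  obtain ⟨j, u', b', h1', hb', hu'⟩ := exists_aeval_eq_pow_mul P hs hq
  have hvu := unit u b hb hu
  have hvu' := unit u' b' hb' hu'
  have hu0 : u' ≠ 0 := by
    rintro rfl; simp at hvu'
  have hs0 : s ≠ 0 ∨ j = 0 := by
    by_contra! h
    rw [h.1] at h1'
    rw [h.1, h1', zero_pow h.2, zero_mul, div_zero] at hz0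
    exact hz0 rfl
  have hb0 : algebraMap F L b' ≠ 0 := by simpa using hb'
  have hclose : P.valuation (u / u' - algebraMap F L (b / b')) < 1 := by
    have : u / u' - algebraMap F L (b / b') = ((u - algebraMap F L b) * algebraMap F L b'
        - algebraMap F L b * (u' - algebraMap F L b')) / (u' * algebraMap F L b') := by
      rw [map_div₀]; field_simp; ring
    rw [this, map_div₀, map_mul, hvu', valuation_algebraMap_eq_one P hb', one_mul, div_one]
    refine Valuation.map_sub_lt _ ?_ ?_
    · rwa [map_mul, valuation_algebraMap_eq_one P hb', mul_one]
    · rwa [map_mul, valuation_algebraMap_eq_one P hb, one_mul]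
  refine ⟨i - j, u / u', b / b', ?_, div_ne_zero hb hb', hclose, by
    rw [map_div₀, hvu, hvu', div_one]⟩
  rw [h1, h1']
  by_cases hs' : s = 0
  · obtain rfl := hs0.resolve_left (not_not.mpr hs')
    simp [mul_div_assoc]
  · rw [zpow_sub₀ hs', zpow_natCast, zpow_natCast]
    field_simp

open IntermediateField in
-- The residue field of F(s) at the place where `s` vanishes is F itself.
theorem exists_algebraMap_close (P : ValuationSubring L) {s : L}
    (hs : P.valuation s < 1) {z : L} (hz : z ∈ F⟮s⟯) (hz1 : P.valuation z ≤ 1) :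
    ∃ b : F, P.valuation (z - algebraMap F L b) < 1 := by
  by_cases hz0 : z = 0
  · exact ⟨0, by simp [hz0]⟩
  obtain ⟨k, u, b, rfl, hb, hub, hu⟩ := exists_eq_zpow_mul_of_mem_adjoin P hs hz hz0
  have hsz : k = 0 ∨ s ≠ 0 := by
    by_contra! h
    rw [h.2, zero_zpow _ h.1, zero_mul] at hz0
    exact hz0 rfl
  rcases hsz with rfl | hs0
  · exact ⟨b, by simpa using hub⟩
  rw [map_mul, hu, mul_one, map_zpow₀] at hz1
  have hspos : 0 < P.valuation s := zero_lt_iff.mpr (P.valuation.ne_zero_iff.mpr hs0)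
  have hk : 0 ≤ k := by
    by_contra! h
    exact hz1.not_gt ((one_lt_zpow_iff_right_of_lt_one₀ hspos hs).mpr h)
  rcases hk.eq_or_lt with rfl | hk
  · exact ⟨b, by simpa using hub⟩
  · refine ⟨0, ?_⟩
    rw [map_zero, sub_zero, map_mul, hu, mul_one, map_zpow₀]
    exact (zpow_lt_one_iff_right_of_lt_one₀ hspos hs).mpr hk

open IntermediateField in
/-- The residue field of a place of a function field is finite. -/
theorem finite_residueField_of_finite_adjoin (P : ValuationSubring L) {s : L}
    (hs : P.valuation s < 1) [FiniteDimensional F⟮s⟯ L] :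
    Finite (IsLocalRing.ResidueField P) := by
  let : Algebra F (IsLocalRing.ResidueField P) :=
    ((IsLocalRing.residue P).comp ((algebraMap F L).codRestrict P.toSubring
      (algebraMap_mem_valuationSubring F P))).toAlgebra
  have hres : ∀ b : F, algebraMap F (IsLocalRing.ResidueField P) b
      = IsLocalRing.residue P ⟨algebraMap F L b, algebraMap_mem_valuationSubring F P b⟩ :=
    fun _ => rfl
  have hzero : ∀ a : P, IsLocalRing.residue P a = 0 ↔ P.valuation (a : L) < 1 := fun a => by
    rw [IsLocalRing.residue_eq_zero_iff, P.valuation_lt_one_iff]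
  have hrank : Module.rank F (IsLocalRing.ResidueField P) ≤ Module.finrank F⟮s⟯ L := by
    refine rank_le fun T hT => ?_
    choose x hx using fun i : IsLocalRing.ResidueField P => IsLocalRing.residue_surjective i
    -- Dividing a relation over F(s) by its coefficient of largest value and reducing gives a
    -- relation between the residues over F, with coefficient 1 at that place.
    have hli : LinearIndependent F⟮s⟯ (fun i : T => (x i : L)) := by
      rw [Fintype.linearIndependent_iff]
      by_contra! h
      obtain ⟨c, hc, i₀, hi₀⟩ := h
      obtain ⟨j, -, hj⟩ := Finset.univ.exists_max_image (fun i => P.valuation (c i : L))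
        ⟨i₀, Finset.mem_univ _⟩
      have hcj : (c j : L) ≠ 0 := by
        intro h0
        have := hj i₀ (Finset.mem_univ _)
        rw [h0, map_zero, le_zero_iff, P.valuation.zero_iff] at this
        exact hi₀ (Subtype.ext this)
      have hle : ∀ i, P.valuation ((c i : L) / c j) ≤ 1 := fun i => by
        rw [map_div₀]
        exact div_le_one_of_le₀ (hj i (Finset.mem_univ _)) zero_le
      choose b hb using fun i => exists_algebraMap_close P hs
        (div_mem (c i).2 (c j).2) (hle i)
      have hsum : ∑ i, ((c i : L) / c j) * x i = 0 := by
        have : ∑ i, (c i : L) * x i = 0 := hc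
        rw [Finset.sum_congr rfl fun i _ => div_mul_eq_mul_div _ _ _, ← Finset.sum_div, this,
          zero_div]
      have hbsum : ∑ i : T, b i • (i : IsLocalRing.ResidueField P) = 0 := by
        have h1 : ∑ i : T, b i • (i : IsLocalRing.ResidueField P) = IsLocalRing.residue P
            (∑ i : T, ⟨algebraMap F L (b i), algebraMap_mem_valuationSubring F P (b i)⟩ * x i) := by
          rw [map_sum]
          refine Finset.sum_congr rfl fun i _ => ?_
          rw [Algebra.smul_def, hres, map_mul, hx]
        rw [h1, hzero]
        push_cast
        rw [← P.valuation.map_neg, ← zero_add (-_), ← hsum, ← sub_eq_add_neg,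
          ← Finset.sum_sub_distrib]
        refine P.valuation.map_sum_lt one_ne_zero fun i _ => ?_
        rw [← sub_mul, map_mul]
        exact mul_lt_of_lt_of_le_one (hb i) (P.valuation_le_one _)
      have hbj := Fintype.linearIndependent_iff.mp hT b hbsum j
      have := hb j
      rw [hbj, map_zero, sub_zero, div_self hcj, map_one] at this
      exact lt_irrefl _ this
    simpa using hli.fintype_card_le_finrank
  have : Module.Finite F (IsLocalRing.ResidueField P) :=
    Module.rank_lt_aleph0_iff.mp (hrank.trans_lt (Cardinal.natCast_lt_aleph0))
  exact Module.finite_of_finite F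

open IntermediateField in
-- In a linear relation over F(s) between 1, x, …, x^n, two nonzero terms have the same value, so a
-- power of v(x) with exponent at most n is a power of v(s). The factorial makes the exponent
-- independent of `x`.
theorem exists_valuation_pow_eq_zpow (P : ValuationSubring L) {s : L}
    (hs : P.valuation s < 1) [FiniteDimensional F⟮s⟯ L] {x : L} (hx : x ≠ 0) :
    ∃ k : ℤ, P.valuation x ^ (Module.finrank F⟮s⟯ L).factorial = P.valuation s ^ k := by
  set n := Module.finrank F⟮s⟯ L
  have hdep : ¬ LinearIndependent F⟮s⟯ (fun i : Fin (n + 1) => x ^ (i : ℕ)) := by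
    intro h
    have := h.fintype_card_le_finrank
    rw [Fintype.card_fin] at this
    omega
  rw [Fintype.not_linearIndependent_iff] at hdep
  obtain ⟨c, hc, i₀, hi₀⟩ := hdep
  have hvx : P.valuation x ≠ 0 := P.valuation.ne_zero_iff.mpr hx
  have hval : ∀ i, P.valuation ((c i : L) * x ^ (i : ℕ)) ≠ 0 →
      ∃ k : ℤ, P.valuation (c i : L) = P.valuation s ^ k := by
    intro i hi
    have h0 : (c i : L) ≠ 0 := fun h => hi (by rw [h, zero_mul, map_zero])
    obtain ⟨k, u, b, h1, -, -, hu⟩ := exists_eq_zpow_mul_of_mem_adjoin P hs (c i).2 h0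
    exact ⟨k, by rw [h1, map_mul, hu, mul_one, map_zpow₀]⟩
  obtain ⟨i, j, hi, hij, hne⟩ : ∃ i j, P.valuation ((c i : L) * x ^ (i : ℕ)) ≠ 0 ∧
      P.valuation ((c i : L) * x ^ (i : ℕ)) = P.valuation ((c j : L) * x ^ (j : ℕ)) ∧ i ≠ j := by
    by_contra! h
    have h1 := P.valuation.map_le_map_sum_of_injOn Finset.univ
      (fun i : Fin (n + 1) => (c i : L) * x ^ (i : ℕ))
      (fun i _ j _ hi hij => h i j hi hij) (Finset.mem_univ i₀)
    have h2 : ∑ i, (c i : L) * x ^ (i : ℕ) = 0 := hc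
    rw [h2, map_zero, le_zero_iff, P.valuation.zero_iff] at h1
    exact hi₀ (Subtype.ext ((mul_eq_zero.mp h1).resolve_right (pow_ne_zero _ hx)))
  have main : ∀ i j : Fin (n + 1), i < j → P.valuation ((c i : L) * x ^ (i : ℕ)) ≠ 0 →
      P.valuation ((c i : L) * x ^ (i : ℕ)) = P.valuation ((c j : L) * x ^ (j : ℕ)) →
      ∃ k : ℤ, P.valuation x ^ n.factorial = P.valuation s ^ k := by
    intro i j hlt hi hij
    obtain ⟨k, hk⟩ := hval i hi
    obtain ⟨l, hl⟩ := hval j (hij ▸ hi)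
    have hsl : P.valuation s ^ l ≠ 0 := by
      rw [← hl]
      intro h0
      rw [hij, map_mul, h0, zero_mul] at hi
      exact hi rfl
    obtain ⟨d, hd⟩ : (j - i : ℕ) ∣ n.factorial :=
      Nat.dvd_factorial (by omega) (by omega)
    have h1 : P.valuation x ^ (j - i : ℕ) = P.valuation s ^ k * (P.valuation s ^ l)⁻¹ := by
      rw [map_mul, map_mul, map_pow, map_pow, hk, hl] at hij
      rw [pow_sub₀ _ hvx hlt.le]
      rw [eq_mul_inv_iff_mul_eq₀ hsl, mul_assoc, mul_comm _ (P.valuation s ^ l), ← mul_assoc,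
        mul_comm (_ ^ (j : ℕ)), ← hij, mul_assoc, mul_inv_cancel₀ (pow_ne_zero _ hvx), mul_one]
    rw [hd, pow_mul, h1]
    by_cases hs0 : P.valuation s = 0
    · have hl0 : l = 0 := by
        by_contra h; exact hsl (by rw [hs0, zero_zpow _ h])
      refine ⟨k * d, ?_⟩
      rw [hl0, zpow_zero, inv_one, mul_one, zpow_mul, zpow_natCast]
    · refine ⟨(k - l) * d, ?_⟩
      rw [zpow_mul, zpow_sub₀ hs0, zpow_natCast, div_eq_mul_inv]
  rcases lt_or_gt_of_ne hne with h | h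
  · exact main i j h hi hij
  · exact main j i h (hij ▸ hi) hij.symm

open IntermediateField in
/-- A place of a function field is discrete. -/
theorem isDiscreteValuationRing_of_finite_adjoin (P : ValuationSubring L) {s : L} (hs0 : s ≠ 0)
    (hs : P.valuation s < 1) [FiniteDimensional F⟮s⟯ L] : IsDiscreteValuationRing P := by
  classical
  set N := (Module.finrank F⟮s⟯ L).factorial with hN
  have hN0 : N ≠ 0 := Nat.factorial_ne_zero _
  have hvs : 0 < P.valuation s := zero_lt_iff.mpr (P.valuation.ne_zero_iff.mpr hs0)
  -- `K` is an integer-valued order function for `P`; an element of least positive order is a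
  -- uniformizer.
  choose! K hK using fun (x : L) (hx : x ≠ 0) => exists_valuation_pow_eq_zpow (F := F) P hs hx
  have hinj := (zpow_right_strictAnti₀ hvs hs).injective
  have hKmul : ∀ x y, x ≠ 0 → y ≠ 0 → K (x * y) = K x + K y := fun x y hx hy => hinj (by
    simp only
    rw [zpow_add₀ hvs.ne', ← hK x hx, ← hK y hy, ← hK _ (mul_ne_zero hx hy), map_mul, mul_pow])
  have hKpos : ∀ x, x ≠ 0 → (0 < K x ↔ P.valuation x < 1) := fun x hx => by
    rw [← zpow_lt_one_iff_right_of_lt_one₀ hvs hs, ← hK x hx, pow_lt_one_iff_of_nonneg zero_le hN0]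
  have hK0 : ∀ x, x ≠ 0 → (0 = K x ↔ P.valuation x = 1) := fun x hx => by
    rw [← pow_eq_one_iff_of_nonneg (a := P.valuation x) zero_le hN0, hK x hx]
    constructor
    · intro h; rw [← h, zpow_zero]
    · intro h; exact hinj (by simp only; rw [zpow_zero, h])
  have hex : ∃ n : ℕ, 0 < n ∧ ∃ x : L, x ≠ 0 ∧ K x = n :=
    ⟨(K s).toNat, by have := (hKpos s hs0).mpr hs; omega, s, hs0, by
      have := (hKpos s hs0).mpr hs; omega⟩
  obtain ⟨hn, ϖ, hϖ0, hϖ⟩ := Nat.find_spec hex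
  have hmin : ∀ x : L, x ≠ 0 → 0 < K x → K ϖ ≤ K x := by
    intro x hx hpos
    have := Nat.find_min' hex ⟨(by omega : 0 < (K x).toNat), x, hx, by omega⟩
    omega
  have hvϖ : P.valuation ϖ < 1 := (hKpos ϖ hϖ0).mp (by omega)
  have hunit : ∀ x : P, x ≠ 0 → ¬ IsUnit x → 0 < K (x : L) := fun x hx hu => by
    rw [hKpos _ (by simpa using hx)]
    exact (P.valuation_lt_one_or_eq_one x).resolve_right fun h =>
      hu ((P.valuation_eq_one_iff x).mpr h)
  refine IsDiscreteValuationRing.ofHasUnitMulPowIrreducibleFactorization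
    ⟨⟨ϖ, (P.valuation_le_one_iff _).mp hvϖ.le⟩, ⟨fun h => ?_, ?_⟩, ?_⟩
  · rw [P.valuation_eq_one_iff] at h
    exact hvϖ.ne h
  · rintro a b hab
    by_contra! h
    have hab' : ϖ = a * b := congrArg Subtype.val hab
    have ha0 : (a : L) ≠ 0 := fun h0 => hϖ0 (by rw [hab', h0, zero_mul])
    have hb0 : (b : L) ≠ 0 := fun h0 => hϖ0 (by rw [hab', h0, mul_zero])
    have ha := hunit a (by simpa using ha0) h.1
    have hb := hunit b (by simpa using hb0) h.2
    have h1 := hmin _ ha0 ha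
    have h2 := hKmul _ _ ha0 hb0
    rw [← hab'] at h2
    omega
  · intro x hx
    have hx0 : (x : L) ≠ 0 := by simpa using hx
    have hKx : 0 ≤ K (x : L) := by
      rcases (P.valuation_lt_one_or_eq_one x) with h | h
      · exact ((hKpos _ hx0).mpr h).le
      · exact ((hK0 _ hx0).mpr h).le
    have hdiv : ∀ n : ℕ, ∀ x : L, x ≠ 0 → 0 ≤ K x → K x ≤ n →
        ∃ m : ℕ, ∃ u : L, x = ϖ ^ m * u ∧ P.valuation u = 1 := by
      intro n
      induction n with
      | zero =>
        intro x hx h1 h2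
        exact ⟨0, x, by simp, (hK0 x hx).mp (by push_cast at h2; omega)⟩
      | succ n ih =>
        intro x hx h1 h2
        rcases h1.eq_or_lt with h | h
        · exact ⟨0, x, by simp, (hK0 x hx).mp h⟩
        have hx' : x / ϖ ≠ 0 := div_ne_zero hx hϖ0
        have h3 := hKmul _ _ hx' hϖ0
        rw [div_mul_cancel₀ _ hϖ0] at h3
        have h4 := hmin x hx h
        obtain ⟨m, u, hu, hu1⟩ := ih (x / ϖ) hx' (by omega) (by push_cast at h2; omega)
        refine ⟨m + 1, u, ?_, hu1⟩
        rw [pow_succ, mul_assoc, mul_comm ϖ, ← mul_assoc, ← hu, div_mul_cancel₀ _ hϖ0]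
    obtain ⟨m, u, hxu, hu⟩ := hdiv (K (x : L)).toNat x hx0 hKx (by omega)
    have huP : IsUnit (⟨u, (P.valuation_le_one_iff _).mp hu.le⟩ : P) :=
      (P.valuation_eq_one_iff _).mpr hu
    exact ⟨m, huP.unit, Subtype.ext (by simp [hxu])⟩

end Place

/-! ### Finding a nonunit over which the field is finite. -/

section FunctionField

open Polynomial IntermediateField

variable {F L : Type*} [Field F] [Finite F] [Field L] [Algebra F L]

/-- A proper valuation ring of a finite extension of `F(t)` contains a nonunit `s` over which the
field is finite. -/
theorem exists_finiteDimensional_adjoin [Algebra (RatFunc F) L] [IsScalarTower F (RatFunc F) L]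
    [FiniteDimensional (RatFunc F) L] (P : ValuationSubring L) (hP : P ≠ ⊤) :
    ∃ s : L, s ≠ 0 ∧ P.valuation s < 1 ∧ FiniteDimensional F⟮s⟯ L := by
  have hrat : ∀ t : L, F⟮t⟯ = F⟮algebraMap (RatFunc F) L RatFunc.X⟯ →
      ∀ f : RatFunc F, algebraMap (RatFunc F) L f ∈ F⟮t⟯ := by
    intro t ht f
    rw [ht, ← RatFunc.num_div_denom f, map_div₀]
    have hpoly : ∀ r : F[X], algebraMap (RatFunc F) L (algebraMap F[X] (RatFunc F) r)
        = aeval (algebraMap (RatFunc F) L RatFunc.X) r := fun r => by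
      rw [aeval_algebraMap_apply, ← RatFunc.algebraMap_X, aeval_algebraMap_apply,
        aeval_X_left_apply]
    rw [hpoly, hpoly, mem_adjoin_simple_iff]
    exact ⟨_, _, rfl⟩
  obtain ⟨t, htP, ht⟩ : ∃ t ∈ P, F⟮t⟯ = F⟮algebraMap (RatFunc F) L RatFunc.X⟯ := by
    rcases P.mem_or_inv_mem (algebraMap (RatFunc F) L RatFunc.X) with h | h
    · exact ⟨_, h, rfl⟩
    · refine ⟨_, h, le_antisymm ?_ ?_⟩
      · rw [adjoin_simple_le_iff]
        exact inv_mem (mem_adjoin_simple_self F _)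
      · rw [adjoin_simple_le_iff]
        exact inv_mem_iff.mp (mem_adjoin_simple_self F _)
  -- If every nonzero polynomial in `t` were a unit, `P` would contain F(t), and with it all of `L`,
  -- which is integral over F(t).
  obtain ⟨a, ha0, ha⟩ : ∃ a : F[X], aeval t a ≠ 0 ∧ P.valuation (aeval t a) < 1 := by
    by_contra! h
    refine hP (eq_top_iff.mpr fun x _ => ?_)
    have hle : ∀ f : RatFunc F, algebraMap (RatFunc F) L f ∈ P := by
      intro f
      obtain ⟨r, q, hrq⟩ := (mem_adjoin_simple_iff F _).mp (hrat t ht f)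
      rw [hrq, ← P.valuation_le_one_iff, map_div₀]
      by_cases hq : aeval t q = 0
      · simp [hq]
      have h1 := h q hq
      refine div_le_one_of_le₀ (le_trans ?_ h1) zero_le
      exact (P.valuation_le_one_iff _).mpr (aeval_mem_valuationSubring P htP r)
    let : Algebra (RatFunc F) P :=
      ((algebraMap (RatFunc F) L).codRestrict P.toSubring hle).toAlgebra
    have : IsScalarTower (RatFunc F) P L := IsScalarTower.of_algebraMap_eq fun _ => rfl
    have hint : IsIntegral P x := (IsIntegral.of_finite (RatFunc F) x).tower_top
    obtain ⟨y, hy⟩ := IsIntegrallyClosed.isIntegral_iff.mp hint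
    rw [← hy]
    exact y.2
  set s := aeval t a with hs
  refine ⟨s, ha0, ha, ?_⟩
  -- `t` is a root of a(X) - s, which is not zero: otherwise `a` would be constant and `s` a unit of
  -- `P`.
  have ht_alg : IsAlgebraic F⟮s⟯ t := by
    refine ⟨a.map (algebraMap F F⟮s⟯) - C (AdjoinSimple.gen F s), ?_, ?_⟩
    · intro h0
      have hdeg : a.natDegree = 0 := by
        have := congrArg natDegree (sub_eq_zero.mp h0)
        rwa [natDegree_map, natDegree_C] at this
      rw [eq_C_of_natDegree_eq_zero hdeg, aeval_C] at hs
      have hb : a.coeff 0 ≠ 0 := by rintro hb; rw [hb, map_zero] at hs; exact ha0 hs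
      rw [hs, valuation_algebraMap_eq_one P hb] at ha
      exact lt_irrefl _ ha
    · simp [← hs]
  have : FiniteDimensional F⟮s⟯ F⟮s⟯⟮t⟯ := adjoin.finiteDimensional ht_alg.isIntegral
  have hmem : ∀ f : RatFunc F, algebraMap (RatFunc F) L f ∈ F⟮s⟯⟮t⟯ := by
    intro f
    have hle : F⟮t⟯ ≤ F⟮s⟯⟮t⟯.restrictScalars F := by
      rw [adjoin_simple_le_iff]
      exact mem_adjoin_simple_self F⟮s⟯ t
    exact hle (hrat t ht f)
  have : FiniteDimensional F⟮s⟯⟮t⟯ L := by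
    obtain ⟨S, hS⟩ := Module.Finite.fg_top (R := RatFunc F) (M := L)
    refine ⟨S, eq_top_iff.mpr fun x _ => ?_⟩
    have hx : x ∈ Submodule.span (RatFunc F) (S : Set L) := hS ▸ Submodule.mem_top
    induction hx using Submodule.span_induction with
    | mem x hx => exact Submodule.subset_span hx
    | zero => exact zero_mem _
    | add x y _ _ hx hy => exact add_mem (hx trivial) (hy trivial)
    | smul f x _ hx =>
      have : f • x = (⟨_, hmem f⟩ : F⟮s⟯⟮t⟯) • x := Algebra.smul_def f x
      rw [this]
      exact Submodule.smul_mem _ _ (hx trivial)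
  exact FiniteDimensional.trans F⟮s⟯ F⟮s⟯⟮t⟯ L

end FunctionField

/-! ### Frobenius elements of decomposition groups -/

section Frobenius

variable (K : Type*) {L : Type*} [Field K] [Field L] [Algebra K L]

/-- One inclusion suffices because `g` has finite order, so that `g⁻¹` is a power of `g`. -/
theorem mem_decompositionSubgroup_iff_le [FiniteDimensional K L] (P : ValuationSubring L)
    (g : L ≃ₐ[K] L) : g ∈ P.decompositionSubgroup K ↔ ∀ x ∈ P, g x ∈ P := by
  have hsmul : ∀ (Q : ValuationSubring L) (g : L ≃ₐ[K] L) x, x ∈ Q → g x ∈ g • Q := fun Q g x hx =>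
    ValuationSubring.smul_mem_pointwise_smul g x Q hx
  constructor
  · intro hg x hx
    have := hsmul P g x hx
    rwa [MulAction.mem_stabilizer_iff.mp hg] at this
  · intro h
    have hpow : ∀ n : ℕ, ∀ x ∈ P, (g ^ n) x ∈ P := by
      intro n
      induction n with
      | zero => intro x hx; simpa using hx
      | succ n ih => intro x hx; rw [pow_succ]; exact ih _ (h x hx)
    have hinv : ∀ x ∈ P, g⁻¹ x ∈ P := by
      intro x hx
      have hn := orderOf_pos g
      have : g⁻¹ = g ^ (orderOf g - 1) := by
        rw [inv_eq_iff_mul_eq_one, ← pow_succ', Nat.sub_add_cancel hn, pow_orderOf_eq_one]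
      rw [this]
      exact hpow _ x hx
    rw [MulAction.mem_stabilizer_iff]
    ext x
    rw [ValuationSubring.mem_pointwise_smul_iff_inv_smul_mem]
    constructor
    · intro hx
      have := h _ hx
      rwa [← AlgEquiv.smul_def, smul_inv_smul] at this
    · exact hinv x

theorem valuation_smul_lt_one (P : ValuationSubring L) (g : P.decompositionSubgroup K) {x : L}
    (hx : P.valuation x < 1) : P.valuation (g • x) < 1 := by
  rw [← ValuationSubring.mem_nonunits_iff, ValuationSubring.mem_nonunits_iff_or] at hx ⊢
  rcases hx with rfl | hx
  · left; exact smul_zero g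
  · right
    intro h
    apply hx
    have := (P.subMulAction K).smul_mem g⁻¹ h
    rwa [← smul_inv'', inv_smul_smul] at this

/-- The intersection of the conjugates of a valuation ring. -/
def conjugateIntersection (P : ValuationSubring L) : Subring L where
  carrier := {x | ∀ g : L ≃ₐ[K] L, g x ∈ P}
  mul_mem' ha hb g := by rw [map_mul]; exact mul_mem (ha g) (hb g)
  one_mem' g := by rw [map_one]; exact one_mem P
  add_mem' ha hb g := by rw [map_add]; exact add_mem (ha g) (hb g)
  zero_mem' g := by rw [map_zero]; exact zero_mem P
  neg_mem' ha g := by rw [map_neg]; exact neg_mem (ha g)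

variable {K}

/-- If the residue field is finite, a valuation ring is a localization of the intersection of its
conjugates. -/
theorem exists_mul_mem_conjugateIntersection {P : ValuationSubring L} {N : ℕ} (hN : 2 ≤ N)
    (hres : ∀ c ∈ P, P.valuation (c ^ N - c) < 1) {y : L} (hy : y ∈ P) :
    ∃ s ∈ conjugateIntersection K P, s * y ∈ conjugateIntersection K P ∧
      P.valuation (s - 1) < 1 := by
  -- For `z` in `P` the term `z ^ N - z` is a nonunit; otherwise `z ^ N` dominates. No integrality
  -- of `z` is assumed, so the bounds apply to all conjugates of `y` at once.
  have key : ∀ z : L, P.valuation ((z ^ N - z + 1)⁻¹) ≤ 1 ∧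
      P.valuation ((z ^ N - z + 1)⁻¹ * z) ≤ 1 := by
    intro z
    rw [map_mul, map_inv₀]
    by_cases hz : z ∈ P
    · have h1 : P.valuation (z ^ N - z + 1) = 1 := by
        rw [← P.valuation.map_one]
        refine P.valuation.map_add_eq_of_lt_right ?_
        rw [P.valuation.map_one]
        exact hres z hz
      rw [h1, inv_one, one_mul]
      exact ⟨le_rfl, (P.valuation_le_one_iff z).mpr hz⟩
    · rw [← P.valuation_le_one_iff, not_le] at hz
      have h1 : P.valuation (z ^ N - z) = P.valuation z ^ N := by
        rw [P.valuation.map_sub_eq_of_lt_left, map_pow]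
        rw [map_pow]
        exact lt_self_pow₀ hz hN
      have h2 : P.valuation (z ^ N - z + 1) = P.valuation z ^ N := by
        rw [P.valuation.map_add_eq_of_lt_left, h1]
        rw [map_one, h1]
        exact one_lt_pow₀ hz (by omega)
      rw [h2]
      have hz0 : 0 < P.valuation z := zero_lt_one.trans hz
      refine ⟨inv_le_one_of_one_le₀ (one_le_pow₀ hz.le), ?_⟩
      rw [inv_mul_le_iff₀ (pow_pos hz0 _), mul_one]
      exact le_self_pow₀ hz.le (by omega)
  refine ⟨(y ^ N - y + 1)⁻¹, fun g => ?_, fun g => ?_, ?_⟩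
  · rw [← P.valuation_le_one_iff]
    simpa using (key (g y)).1
  · rw [← P.valuation_le_one_iff]
    simpa using (key (g y)).2
  · have h1 := hres y hy
    have h2 : P.valuation (y ^ N - y + 1) = 1 := by
      rw [← P.valuation.map_one]
      refine P.valuation.map_add_eq_of_lt_right ?_
      rwa [P.valuation.map_one]
    have h3 : y ^ N - y + 1 ≠ 0 := by rw [← P.valuation.ne_zero_iff, h2]; exact one_ne_zero
    rw [show (y ^ N - y + 1)⁻¹ - 1 = -((y ^ N - y) * (y ^ N - y + 1)⁻¹) by field_simp; ring,
      P.valuation.map_neg, map_mul, map_inv₀, h2, inv_one, mul_one]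
    exact h1

instance (P : ValuationSubring L) : MulSemiringAction (L ≃ₐ[K] L) (conjugateIntersection K P) where
  smul g x := ⟨g x, fun h => x.2 (h * g)⟩
  one_smul _ := rfl
  mul_smul _ _ _ := rfl
  smul_zero g := Subtype.ext (map_zero g)
  smul_add g x y := Subtype.ext (map_add g x.1 y.1)
  smul_one g := Subtype.ext (map_one g)
  smul_mul g x y := Subtype.ext (map_mul g x.1 y.1)

theorem conjugateIntersection_le (P : ValuationSubring L) :
    conjugateIntersection K P ≤ P.toSubring := fun _ hx => hx 1

/-- The intersection `R` of the conjugates of `P` is stable under the Galois group with invariants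
`𝔭`, so the stabilizer of the prime `Q` that `P` cuts out on `R` maps onto the automorphisms of R/Q.
The stabilizer is the decomposition group, `R` represents all residues of `P`, and powers of
Frobenius exhaust the automorphisms of a finite field. -/
theorem exists_frobenius [FiniteDimensional K L] [IsGalois K L] (𝔭 : ValuationSubring K)
    (P : ValuationSubring L) (hP : P.comap (algebraMap K L) = 𝔭)
    [Finite (IsLocalRing.ResidueField P)] :
    ∃ φ : P.decompositionSubgroup K,
      (∀ c ∈ P, P.valuation (φ • c - c ^ Nat.card (IsLocalRing.ResidueField 𝔭)) < 1) ∧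
      ∀ g : P.decompositionSubgroup K, ∃ n : ℕ, ∀ c ∈ P, P.valuation (g • c - φ ^ n • c) < 1 := by
  have hmem𝔭 : ∀ a : K, a ∈ 𝔭 ↔ algebraMap K L a ∈ P := fun a => by rw [← hP]; rfl
  let R := conjugateIntersection K P
  let i : R →+* P := Subring.inclusion (conjugateIntersection_le P)
  have hi : ∀ b : R, ((i b : P) : L) = b := fun _ => rfl
  let : Algebra 𝔭 R := (((algebraMap K L).comp 𝔭.subtype).codRestrict R fun a g => by
    simpa using (hmem𝔭 a).mp a.2).toAlgebra
  have halg : ∀ a : 𝔭, ((algebraMap 𝔭 R a : R) : L) = algebraMap K L a := fun _ => rfl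
  have hsmul : ∀ (g : L ≃ₐ[K] L) (b : R), ((g • b : R) : L) = g b := fun _ _ => rfl
  have : Algebra.IsInvariant 𝔭 R (L ≃ₐ[K] L) := ⟨fun b hb => by
    obtain ⟨a, ha⟩ := (IsGalois.mem_bot_iff_fixed (F := K) (b : L)).mpr
      (fun g => congrArg Subtype.val (hb g))
    refine ⟨⟨a, (hmem𝔭 a).mpr ?_⟩, Subtype.ext ha⟩
    have : algebraMap K L a = b := ha
    rw [this]
    exact b.2 1⟩
  have : SMulCommClass (L ≃ₐ[K] L) 𝔭 R := ⟨fun g a b => Subtype.ext (by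
    rw [Algebra.smul_def, Algebra.smul_def, hsmul]
    simp [halg, hsmul])⟩
  let Q : Ideal R := (IsLocalRing.maximalIdeal P).comap i
  have hQ : ∀ b : R, b ∈ Q ↔ P.valuation (b : L) < 1 := fun b =>
    (P.valuation_lt_one_iff (i b))
  have : Q.IsPrime := Ideal.IsPrime.comap i
  have : Q.LiesOver (IsLocalRing.maximalIdeal 𝔭) := ⟨by
    ext a
    rw [Ideal.under_def, Ideal.mem_comap, hQ, halg, ← ValuationSubring.coe_mem_nonunits_iff,
      ← ValuationSubring.mem_nonunits_iff, ValuationSubring.mem_nonunits_iff_or,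
      ValuationSubring.mem_nonunits_iff_or, hmem𝔭, map_inv₀, map_eq_zero]⟩
  set N := Nat.card (IsLocalRing.ResidueField P) with hNdef
  have hN2 : 2 ≤ N := Finite.one_lt_card
  have hres : ∀ c ∈ P, P.valuation (c ^ N - c) < 1 := fun c hc => by
    have := Fintype.ofFinite (IsLocalRing.ResidueField P)
    have h1 := FiniteField.pow_card (IsLocalRing.residue P ⟨c, hc⟩)
    rw [← Nat.card_eq_fintype_card, ← hNdef, ← map_pow, ← sub_eq_zero, ← map_sub,
      IsLocalRing.residue_eq_zero_iff, P.valuation_lt_one_iff] at h1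
    exact h1
  have hloc : ∀ c ∈ P, ∃ b : R, P.valuation (c - b) < 1 := fun c hc => by
    obtain ⟨s, hs, hsc, hs1⟩ := exists_mul_mem_conjugateIntersection (K := K) hN2 hres hc
    refine ⟨⟨s * c, hsc⟩, ?_⟩
    rw [show c - s * c = -((s - 1) * c) by ring, P.valuation.map_neg, map_mul]
    exact mul_lt_of_lt_of_le_one hs1 ((P.valuation_le_one_iff c).mpr hc)
  -- The denominator `s` is congruent to 1. If `g s` were a nonunit it would lie in `Q = g • Q`,
  -- which would put `s` in `Q`.
  have hdec : ∀ g ∈ MulAction.stabilizer (L ≃ₐ[K] L) Q, g ∈ P.decompositionSubgroup K := by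
    intro g hg
    rw [mem_decompositionSubgroup_iff_le]
    intro x hx
    obtain ⟨s, hs, hsx, hs1⟩ := exists_mul_mem_conjugateIntersection (K := K) hN2 hres hx
    have hgs : P.valuation (g s) = 1 := by
      refine le_antisymm ((P.valuation_le_one_iff _).mpr (hs g)) (not_lt.mp fun h => ?_)
      have h1 : g • (⟨s, hs⟩ : R) ∈ g • Q := by
        rw [MulAction.mem_stabilizer_iff.mp hg, hQ]; exact h
      rw [Ideal.smul_mem_pointwise_smul_iff, hQ] at h1
      have h2 := P.valuation.map_sub_lt h1 hs1
      simp at h2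
    rw [← P.valuation_le_one_iff]
    have h1 := (P.valuation_le_one_iff _).mpr (hsx g)
    rwa [map_mul, map_mul, hgs, one_mul] at h1
  have hstab : ∀ g ∈ P.decompositionSubgroup K, g ∈ MulAction.stabilizer (L ≃ₐ[K] L) Q := by
    intro g hg
    rw [MulAction.mem_stabilizer_iff]
    ext b
    rw [Ideal.mem_pointwise_smul_iff_inv_smul_mem, hQ, hQ]
    constructor
    · intro h
      have := valuation_smul_lt_one K P ⟨g, hg⟩ h
      have h2 : (⟨g, hg⟩ : P.decompositionSubgroup K) • ((g⁻¹ • b : R) : L) = b := by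
        change g (g⁻¹ (b : L)) = b
        rw [← AlgEquiv.mul_apply, mul_inv_cancel]
        rfl
      rwa [h2] at this
    · exact fun h => valuation_smul_lt_one K P (⟨g, hg⟩ : P.decompositionSubgroup K)⁻¹ h
  have : Finite (P ⧸ IsLocalRing.maximalIdeal P) := ‹Finite (IsLocalRing.ResidueField P)›
  have : Finite (R ⧸ Q) :=
    Finite.of_injective (β := P ⧸ IsLocalRing.maximalIdeal P)
      (Ideal.quotientMap (IsLocalRing.maximalIdeal P) i le_rfl) Ideal.quotientMap_injective
  have : Q.IsMaximal := Ideal.Quotient.maximal_of_isField _ (Finite.isField_of_domain _)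
  let : Field (R ⧸ Q) := Ideal.Quotient.field Q
  let : Field (𝔭 ⧸ IsLocalRing.maximalIdeal 𝔭) := Ideal.Quotient.field _
  have : Finite (𝔭 ⧸ IsLocalRing.maximalIdeal 𝔭) :=
    Finite.of_injective _ (algebraMap (𝔭 ⧸ IsLocalRing.maximalIdeal 𝔭) (R ⧸ Q)).injective
  have := Fintype.ofFinite (𝔭 ⧸ IsLocalRing.maximalIdeal 𝔭)
  let τ := FiniteField.frobeniusAlgEquivOfAlgebraic (𝔭 ⧸ IsLocalRing.maximalIdeal 𝔭) (R ⧸ Q)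
  have hmk : ∀ b b' : R, Ideal.Quotient.mk Q b = Ideal.Quotient.mk Q b' ↔
      P.valuation ((b : L) - b') < 1 := fun b b' => by
    rw [Ideal.Quotient.eq, hQ]; rfl
  obtain ⟨φ, hφ⟩ := Ideal.Quotient.stabilizerHom_surjective (L ≃ₐ[K] L)
    (IsLocalRing.maximalIdeal 𝔭) Q τ
  have happrox : ∀ (g : P.decompositionSubgroup K) (c : L) (b : R), P.valuation (c - b) < 1 →
      P.valuation (g • c - ((g : L ≃ₐ[K] L) • b : R)) < 1 := fun g c b h => by
    have := valuation_smul_lt_one K P g h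
    rwa [smul_sub] at this
  refine ⟨⟨φ, hdec φ φ.2⟩, fun c hc => ?_, fun g => ?_⟩
  · obtain ⟨b, hb⟩ := hloc c hc
    have hq : Nat.card (IsLocalRing.ResidueField 𝔭)
        = Fintype.card (𝔭 ⧸ IsLocalRing.maximalIdeal 𝔭) :=
      Nat.card_eq_fintype_card (α := 𝔭 ⧸ IsLocalRing.maximalIdeal 𝔭)
    rw [hq]
    set q := Fintype.card (𝔭 ⧸ IsLocalRing.maximalIdeal 𝔭)
    have h1 : Ideal.Quotient.mk Q (φ.1 • b) = Ideal.Quotient.mk Q (b ^ q) := by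
      rw [map_pow]
      exact DFunLike.congr_fun hφ (Ideal.Quotient.mk Q b)
    rw [hmk] at h1
    have h2 : P.valuation (c ^ q - (b : L) ^ q) < 1 := by
      rw [← Commute.geom_sum₂_mul (Commute.all _ _), map_mul, mul_comm]
      refine mul_lt_of_lt_of_le_one hb ((P.valuation_le_one_iff _).mpr (sum_mem fun j _ => ?_))
      exact mul_mem (pow_mem hc _) (pow_mem (b.2 1) _)
    have h3 := happrox ⟨φ, hdec φ φ.2⟩ c b hb
    have h4 := P.valuation.map_sub_lt (P.valuation.map_add_lt h3 h1) h2
    convert h4 using 2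
    push_cast
    ring
  · obtain ⟨n, hn⟩ := (FiniteField.bijective_frobeniusAlgEquivOfAlgebraic_pow
      (𝔭 ⧸ IsLocalRing.maximalIdeal 𝔭) (R ⧸ Q)).2
      (Ideal.Quotient.stabilizerHom Q (IsLocalRing.maximalIdeal 𝔭) (L ≃ₐ[K] L) ⟨g, hstab g g.2⟩)
    simp only at hn
    change τ ^ n.1 = _ at hn
    rw [← hφ, ← map_pow] at hn
    refine ⟨n, fun c hc => ?_⟩
    obtain ⟨b, hb⟩ := hloc c hc
    have h1 : Ideal.Quotient.mk Q ((φ ^ n.1).1 • b) = Ideal.Quotient.mk Q (g.1 • b) :=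
      DFunLike.congr_fun hn (Ideal.Quotient.mk Q b)
    rw [hmk, P.valuation.map_sub_swap] at h1
    have h2 := P.valuation.map_sub_lt (P.valuation.map_add_lt (happrox g c b hb) h1)
      (happrox (⟨φ, hdec φ φ.2⟩ ^ n.1) c b hb)
    convert h2 using 2
    push_cast
    ring

end Frobenius

/-! ### The upper numbering -/

section Herbrand

variable {K : Type*} {L : Type*} [Field K] [Field L] [Algebra K L]

theorem lowerRamificationGroup_antitone (P : ValuationSubring L) :
    Antitone (lowerRamificationGroup K P) := by
  intro u w huw g hg x
  refine Ideal.pow_le_pow_right ?_ (hg x)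
  have := Int.ceil_mono huw
  omega

variable [FiniteDimensional K L] (P : ValuationSubring L)

theorem inv_relIndex_antitone :
    Antitone fun t : ℝ => (((lowerRamificationGroup K P t).relIndex
      (lowerRamificationGroup K P 0) : ℕ) : ℝ)⁻¹ := by
  intro t t' h
  have h1 : (lowerRamificationGroup K P t).relIndex (lowerRamificationGroup K P 0) ≠ 0 :=
    Subgroup.index_ne_zero_of_finite
  refine inv_anti₀ (by exact_mod_cast Nat.pos_of_ne_zero h1) (Nat.cast_le.mpr ?_)
  exact Subgroup.relIndex_le_of_le_left (lowerRamificationGroup_antitone P h)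
    Subgroup.index_ne_zero_of_finite

theorem herbrandPhi_sub (a b : ℝ) : herbrandPhi K P b - herbrandPhi K P a =
    ∫ t in a..b, (((lowerRamificationGroup K P t).relIndex
      (lowerRamificationGroup K P 0) : ℕ) : ℝ)⁻¹ :=
  intervalIntegral.integral_interval_sub_left (inv_relIndex_antitone P).intervalIntegrable
    (inv_relIndex_antitone P).intervalIntegrable

/-- The integrand is at least the inverse of the order of the decomposition group. The linear bound
makes φ both unbounded above and strictly increasing. -/
theorem exists_pos_mul_sub_le_herbrandPhi_sub :
    ∃ δ : ℝ, 0 < δ ∧ ∀ a b : ℝ, a ≤ b → δ * (b - a) ≤ herbrandPhi K P b - herbrandPhi K P a := by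
  have hpos : 0 < (Nat.card (P.decompositionSubgroup K) : ℝ) := by exact_mod_cast Nat.card_pos
  refine ⟨(Nat.card (P.decompositionSubgroup K) : ℝ)⁻¹, inv_pos.mpr hpos, fun a b hab => ?_⟩
  rw [herbrandPhi_sub]
  have h1 := intervalIntegral.integral_mono_on (μ := MeasureTheory.volume) hab
    (intervalIntegrable_const (c := (Nat.card (P.decompositionSubgroup K) : ℝ)⁻¹))
    (inv_relIndex_antitone (K := K) P).intervalIntegrable (fun t _ => ?_)
  · rwa [intervalIntegral.integral_const, smul_eq_mul, mul_comm] at h1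
  · have h1 : (lowerRamificationGroup K P t).relIndex (lowerRamificationGroup K P 0) ≠ 0 :=
      Subgroup.index_ne_zero_of_finite
    refine inv_anti₀ (by exact_mod_cast Nat.pos_of_ne_zero h1) (Nat.cast_le.mpr ?_)
    exact (Nat.le_of_dvd Nat.card_pos (Subgroup.relIndex_dvd_card _ _)).trans
      (Nat.le_of_dvd Nat.card_pos (Subgroup.card_subgroup_dvd_card _))

/-- ψ is defined by choosing a preimage, so only its existence is at stake: it follows from the
intermediate value theorem and the growth of φ. -/
theorem herbrandPhi_herbrandPsi {w : ℝ} (hw : 0 ≤ w) :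
    herbrandPhi K P (herbrandPsi K P w) = w := by
  refine Function.invFunOn_eq ?_
  obtain ⟨δ, hδ, h⟩ := exists_pos_mul_sub_le_herbrandPhi_sub (K := K) P
  have hcont : Continuous (herbrandPhi K P) :=
    intervalIntegral.continuous_primitive
      (fun a b => (inv_relIndex_antitone P).intervalIntegrable) 0
  have h0 : herbrandPhi K P 0 = 0 := intervalIntegral.integral_same
  have hU : 0 ≤ w / δ := by positivity
  obtain ⟨u, hu, hu'⟩ := intermediate_value_Icc hU hcont.continuousOn
    (show w ∈ Set.Icc (herbrandPhi K P 0) (herbrandPhi K P (w / δ)) from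
      ⟨h0.symm ▸ hw, by
        have := h 0 (w / δ) hU
        rwa [h0, sub_zero, sub_zero, mul_div_cancel₀ _ hδ.ne'] at this⟩)
  exact ⟨u, by have := hu.1; simp only [Set.mem_Ici]; linarith, hu'⟩

/-- On (k, k+1] the integrand is the constant |G_(k+1)| / |G_0|; the added 1 accounts for the term i
= 0. -/
theorem card_mul_herbrandPhi_natCast (s : ℕ) :
    Nat.card (lowerRamificationGroup K P 0) * (herbrandPhi K P s + 1) =
      ∑ i ∈ Finset.range (s + 1), (Nat.card (lowerRamificationGroup K P (i : ℝ)) : ℝ) := by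
  have h1 : ∀ k : ℕ, Nat.card (lowerRamificationGroup K P 0) *
      (herbrandPhi K P ((k + 1 : ℕ) : ℝ) - herbrandPhi K P k) =
        (Nat.card (lowerRamificationGroup K P ((k + 1 : ℕ) : ℝ)) : ℝ) := by
    intro k
    have hconst : ∫ t in (k : ℝ)..((k + 1 : ℕ) : ℝ), (((lowerRamificationGroup K P t).relIndex
        (lowerRamificationGroup K P 0) : ℕ) : ℝ)⁻¹ =
        ∫ t in (k : ℝ)..((k + 1 : ℕ) : ℝ), (((lowerRamificationGroup K P ((k + 1 : ℕ) : ℝ)).relIndex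
        (lowerRamificationGroup K P 0) : ℕ) : ℝ)⁻¹ := by
      have hle : (k : ℝ) ≤ ((k + 1 : ℕ) : ℝ) := by push_cast; linarith
      rw [intervalIntegral.integral_of_le hle, intervalIntegral.integral_of_le hle]
      refine MeasureTheory.setIntegral_congr_fun measurableSet_Ioc fun t ht => ?_
      have hc : ⌈t⌉ = ⌈((k + 1 : ℕ) : ℝ)⌉ := by
        rw [Int.ceil_natCast, Int.ceil_eq_iff]
        refine ⟨?_, by exact_mod_cast ht.2⟩
        have := ht.1
        push_cast
        linarith
      simp only [lowerRamificationGroup, hc]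
    rw [herbrandPhi_sub, hconst, intervalIntegral.integral_const, smul_eq_mul]
    have hle : lowerRamificationGroup K P ((k + 1 : ℕ) : ℝ) ≤ lowerRamificationGroup K P 0 :=
      lowerRamificationGroup_antitone P (Nat.cast_nonneg _)
    have hmul := Subgroup.relIndex_mul_relIndex ⊥ _ _ bot_le hle
    rw [Subgroup.relIndex_bot_left, Subgroup.relIndex_bot_left] at hmul
    have hne : (lowerRamificationGroup K P ((k + 1 : ℕ) : ℝ)).relIndex
      (lowerRamificationGroup K P 0) ≠ 0 := Subgroup.index_ne_zero_of_finite
    have hne' : (((lowerRamificationGroup K P ((k + 1 : ℕ) : ℝ)).relIndex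
      (lowerRamificationGroup K P 0) : ℕ) : ℝ) ≠ 0 := by exact_mod_cast hne
    rw [← hmul]
    push_cast at hne' ⊢
    field_simp
    ring
  have h0 : herbrandPhi K P 0 = 0 := intervalIntegral.integral_same
  induction s with
  | zero => simp [h0]
  | succ s ih => rw [Finset.sum_range_succ, ← ih, ← h1]; ring

/-- A bound for the breaks in terms of the upper numbering. -/
theorem lt_of_upperRamificationGroup_eq_bot {ν : ℕ} (hν : upperRamificationGroup K P ν = ⊥)
    {s m : ℕ} (hs : lowerRamificationGroup K P (s : ℝ) ≠ ⊥)
    (hm : Nat.card (lowerRamificationGroup K P 0) * (m + 1) ≤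
      ∑ i ∈ Finset.range (s + 1), Nat.card (lowerRamificationGroup K P (i : ℝ))) : m < ν := by
  have hphi : (m : ℝ) ≤ herbrandPhi K P s := by
    have h1 : (Nat.card (lowerRamificationGroup K P 0) : ℝ) * (m + 1) ≤
        Nat.card (lowerRamificationGroup K P 0) * (herbrandPhi K P s + 1) := by
      rw [card_mul_herbrandPhi_natCast]
      exact_mod_cast hm
    have h2 := le_of_mul_le_mul_left h1 (by exact_mod_cast Nat.card_pos)
    linarith
  have hpsi := herbrandPhi_herbrandPsi (K := K) P (Nat.cast_nonneg (α := ℝ) ν)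
  -- For s ≥ ψ(ν) the group G_s would lie in G^ν = 1. Strict growth of φ then gives m ≤ φ(s) <
  -- φ(ψ(ν)) = ν.
  have hlt : (s : ℝ) < herbrandPsi K P ν := by
    by_contra! h
    exact hs (le_bot_iff.mp (hν ▸ lowerRamificationGroup_antitone P h))
  obtain ⟨δ, hδ, h⟩ := exists_pos_mul_sub_le_herbrandPhi_sub (K := K) P
  have h1 := h _ _ hlt.le
  have h2 : 0 < δ * (herbrandPsi K P ν - s) := mul_pos hδ (sub_pos.mpr hlt)
  rw [hpsi] at h1
  exact_mod_cast (show (m : ℝ) < ν by linarith)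

end Herbrand

/-! ### The normalized valuation of a discrete place -/

section NormalizedValuation

/-- The normalized valuation of a discrete valuation ring. -/
theorem exists_normalized_valuation {L : Type*} [Field L] (P : ValuationSubring L)
    [IsDiscreteValuationRing P] :
    ∃ v : Valuation L ℤᵐ⁰, (∀ x, v x ≤ 1 ↔ x ∈ P) ∧ (∃ π, v π = exp (-1 : ℤ)) ∧
      ∀ (x : P) (n : ℕ), x ∈ IsLocalRing.maximalIdeal P ^ n ↔ v x ≤ exp (-(n : ℤ)) := by
  let w := IsDiscreteValuationRing.maximalIdeal P
  refine ⟨w.valuation L, fun x => ⟨fun hx => ?_, fun hx => ?_⟩, w.valuation_exists_uniformizer L,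
    fun x n => ?_⟩
  · obtain ⟨y, hy⟩ := IsDedekindDomain.HeightOneSpectrum.mem_integers_of_valuation_le_one L x
      (fun w' => by
      have : w' = w := by
        ext1
        exact IsLocalRing.eq_maximalIdeal (w'.isPrime.isMaximal w'.ne_bot)
      rwa [this])
    rw [← hy]
    exact y.2
  · exact w.valuation_le_one ⟨x, hx⟩
  · change x ∈ w.asIdeal ^ n ↔ w.valuation L (algebraMap P L x) ≤ _
    rw [w.valuation_of_algebraMap, w.intValuation_le_pow_iff_mem]

variable {L G : Type*} [Field L] [Group G] [MulSemiringAction G L]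

/-- A group preserving a discrete valuation ring preserves its normalized valuation. -/
theorem map_smul_eq_of_forall_le_one (v : Valuation L ℤᵐ⁰) {π : L} (hπ : v π = exp (-1 : ℤ))
    (h : ∀ (g : G) (x : L), v x ≤ 1 → v (g • x) ≤ 1) (g : G) (x : L) : v (g • x) = v x := by
  have hunit : ∀ (g : G) (x : L), v x = 1 → v (g • x) = 1 := by
    intro g x hx
    refine le_antisymm (h g x hx.le) ?_
    have h1 := h g x⁻¹ (by rw [map_inv₀, hx, inv_one])
    rw [smul_inv'', map_inv₀] at h1
    have h2 : g • x ≠ 0 := by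
      rw [Ne, smul_eq_zero_iff_eq]
      rintro rfl
      simp at hx
    exact (inv_le_one₀ (zero_lt_iff.mpr (v.ne_zero_iff.mpr h2))).mp h1
  -- Units go to units in both directions, so a uniformizer goes to a nonunit. Hence no integral
  -- value increases, and applying `g⁻¹` gives equality.
  have hlt : ∀ (g : G), v (g • π) ≤ exp (-1 : ℤ) := by
    intro g
    rw [← WithZero.lt_one_iff_le_exp]
    refine (h g π ?_).lt_of_ne fun h1 => ?_
    · rw [hπ]; exact WithZero.exp_neg_one_lt_one.le
    · have h2 := hunit g⁻¹ _ h1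
      rw [inv_smul_smul, hπ] at h2
      exact WithZero.exp_neg_one_lt_one.ne h2
  have hpow : ∀ (g : G) (x : L), v x ≤ 1 → v (g • x) ≤ v x := by
    intro g x hx
    by_cases h0 : x = 0
    · simp [h0]
    have hvx : v x ≠ 0 := v.ne_zero_iff.mpr h0
    obtain ⟨n, hn⟩ : ∃ n : ℕ, v x = exp (-(n : ℤ)) := by
      rw [← exp_log hvx, ← exp_zero, exp_le_exp] at hx
      exact ⟨(-log (v x)).toNat, by rw [← exp_log hvx, exp_inj, log_exp]; omega⟩
    have hpn : v π ^ n = exp (-(n : ℤ)) := by rw [hπ, ← exp_nsmul]; simp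
    have hu : v (x / π ^ n) = 1 := by
      rw [map_div₀, map_pow, hpn, hn, div_self exp_ne_zero]
    have hπ0 : π ≠ 0 := by rw [← v.ne_zero_iff, hπ]; exact exp_ne_zero
    rw [show x = π ^ n * (x / π ^ n) by field_simp, smul_mul', smul_pow', map_mul, map_pow,
      hunit g _ hu, map_mul, hu, map_pow, hπ]
    exact mul_le_mul_left (pow_le_pow_left₀ zero_le (hlt g) n) _
  have hint : ∀ (g : G) (x : L), v x ≤ 1 → v (g • x) = v x := by
    intro g x hx
    refine le_antisymm (hpow g x hx) ?_
    have := hpow g⁻¹ (g • x) (h g x hx)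
    rwa [inv_smul_smul] at this
  rcases le_total (v x) 1 with hx | hx
  · exact hint g x hx
  · have := hint g x⁻¹ (by rw [map_inv₀]; exact inv_le_one_of_one_le₀ hx)
    rwa [smul_inv'', map_inv₀, map_inv₀, inv_inj] at this

end NormalizedValuation

/-! ### The main theorem -/

/-- A bound for the number of characters of order `p` of a decomposition group in terms of the
ramification depth. -/
theorem card_characters_decompositionSubgroup_le {p : ℕ} [Fact p.Prime] {K L : Type*} [Field K]
    [Field L] [Algebra K L] [FiniteDimensional K L] [IsGalois K L] [CharP L p]
    (P : ValuationSubring L) [IsDiscreteValuationRing P] [Finite (IsLocalRing.ResidueField P)]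
    (𝔭 : ValuationSubring K) [Finite (IsLocalRing.ResidueField 𝔭)]
    (hP : P.comap (algebraMap K L) = 𝔭) {ν : ℕ} (hν : upperRamificationGroup K P ν = ⊥) :
    Nat.card (P.decompositionSubgroup K →* Multiplicative (ZMod p)) ≤
      p * Nat.card (IsLocalRing.ResidueField 𝔭) ^ (ν - 1) := by
  classical
  obtain ⟨v, hvP, ⟨π, hπ⟩, hvpow⟩ := exists_normalized_valuation P
  have hlt : ∀ x, v x < 1 ↔ P.valuation x < 1 := fun x => by
    by_cases h0 : x = 0
    · simp [h0]
    rw [← ValuationSubring.mem_nonunits_iff, ValuationSubring.mem_nonunits_iff_or, ← hvP, map_inv₀,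
      inv_le_one₀ (zero_lt_iff.mpr (v.ne_zero_iff.mpr h0)), not_le]
    simp [h0]
  have hres : ∀ a : P, IsLocalRing.residue P a = 0 ↔ v a < 1 := fun a => by
    rw [IsLocalRing.residue_eq_zero_iff, P.valuation_lt_one_iff, hlt]
  have hv : ∀ (g : P.decompositionSubgroup K) (x : L), v (g • x) = v x :=
    map_smul_eq_of_forall_le_one v hπ fun g x hx =>
      (hvP _).mpr ((P.subMulAction K).smul_mem g ((hvP x).mp hx))
  have hram : ∀ i : ℕ, lowerRamificationGroup K P (i : ℝ) = isometryRamificationGroup v hv i := by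
    intro i
    ext g
    have hexp : (⌈(i : ℝ)⌉ + 1).toNat = i + 1 := by rw [Int.ceil_natCast]; omega
    have key : ∀ x : P, g • x - x ∈ (IsLocalRing.maximalIdeal P ^ (⌈(i : ℝ)⌉ + 1).toNat) ↔
        v (g • (x : L) - x) ≤ exp (-((i : ℤ) + 1)) := fun x => by
      rw [hexp, hvpow]
      push_cast
      rfl
    exact ⟨fun h c hc => (key ⟨c, (hvP c).mp hc⟩).mp (h _),
      fun h x => (key x).mpr (h x ((hvP x).mpr x.2))⟩
  have : CharP (IsLocalRing.ResidueField P) p := by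
    have : CharP P p := P.subtype.charP P.subtype_injective p
    refine (CharP.charP_iff_prime_eq_zero Fact.out).mpr ?_
    rw [← map_natCast (IsLocalRing.residue P), CharP.cast_eq_zero, map_zero]
  have := Fintype.ofFinite (IsLocalRing.ResidueField P)
  obtain ⟨r, -, hr⟩ := FiniteField.card (IsLocalRing.ResidueField P) p
  have hN : ∀ c, v c ≤ 1 → v (c ^ p ^ (r : ℕ) - c) < 1 := fun c hc => by
    rw [← hr]
    exact (hres (⟨c, (hvP c).mp hc⟩ ^ _ - ⟨c, (hvP c).mp hc⟩)).mp
      (by rw [map_sub, map_pow, FiniteField.pow_card, sub_self])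
  obtain ⟨ζ, hζ⟩ := IsCyclic.exists_monoid_generator (α := (IsLocalRing.ResidueField P)ˣ)
  obtain ⟨ξ, hξ⟩ := IsLocalRing.residue_surjective (ζ : IsLocalRing.ResidueField P)
  have hgen : ∀ c, v c ≤ 1 → v c < 1 ∨ ∃ n : ℕ, v (c - (ξ : L) ^ n) < 1 := by
    intro c hc
    set c' : P := ⟨c, (hvP c).mp hc⟩ with hc'
    by_cases h0 : IsLocalRing.residue P c' = 0
    · exact Or.inl ((hres c').mp h0)
    · obtain ⟨n, hn⟩ := hζ (Units.mk0 _ h0)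
      refine Or.inr ⟨n, (hres (c' - ξ ^ n)).mp ?_⟩
      have := congrArg Units.val hn
      rw [map_sub, map_pow, hξ, sub_eq_zero]
      simpa using this.symm
  obtain ⟨φ, hφ, hφgen⟩ := exists_frobenius 𝔭 P hP
  set q := Nat.card (IsLocalRing.ResidueField 𝔭) with hq
  have hq2 : 1 < q := Finite.one_lt_card
  -- Frobenius fixes the decomposition field, so residues of its integral elements are roots of X^q
  -- - X. This bounds their number by `q` without identifying that residue field with the one of
  -- `𝔭`. Outside such elements `res` takes the default value 0.
  let S := {x : IsLocalRing.ResidueField P // x ^ q = x}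
  let res : L → S := fun c =>
    if h : ∃ hc : c ∈ P, (IsLocalRing.residue P ⟨c, hc⟩) ^ q = IsLocalRing.residue P ⟨c, hc⟩ then
      ⟨_, h.choose_spec⟩ else ⟨0, zero_pow (by omega)⟩
  have hfixq : ∀ c (hc : c ∈ P), φ • c = c →
      (IsLocalRing.residue P ⟨c, hc⟩) ^ q = IsLocalRing.residue P ⟨c, hc⟩ := by
    intro c hc hfix
    rw [← map_pow, ← sub_eq_zero, ← map_sub, ← neg_eq_zero, ← map_neg, hres]
    have := hφ c hc
    rw [hfix, ← hlt] at this
    simpa using this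
  have hSres : ∀ c c' : L, (∀ g : P.decompositionSubgroup K, g • c = c) →
      (∀ g : P.decompositionSubgroup K, g • c' = c') → v c ≤ 1 → v c' ≤ 1 →
      res c = res c' → v (c - c') < 1 := by
    intro c c' hc hc' h1 h1' heq
    have h2 : ∃ h : c ∈ P, (IsLocalRing.residue P ⟨c, h⟩) ^ q = IsLocalRing.residue P ⟨c, h⟩ :=
      ⟨(hvP c).mp h1, hfixq c _ (hc φ)⟩
    have h2' : ∃ h : c' ∈ P, (IsLocalRing.residue P ⟨c', h⟩) ^ q
        = IsLocalRing.residue P ⟨c', h⟩ := ⟨(hvP c').mp h1', hfixq c' _ (hc' φ)⟩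
    simp only [res, dif_pos h2, dif_pos h2'] at heq
    have heq : IsLocalRing.residue P ⟨c, (hvP c).mp h1⟩
        = IsLocalRing.residue P ⟨c', (hvP c').mp h1'⟩ := congrArg Subtype.val heq
    rw [← sub_eq_zero, ← map_sub, hres] at heq
    exact heq
  have hS : Nat.card S ≤ q := by
    open Polynomial in
    have hne : (X ^ q - X : (IsLocalRing.ResidueField P)[X]) ≠ 0 :=
      FiniteField.X_pow_card_sub_X_ne_zero _ hq2
    open Polynomial in
    calc Nat.card S ≤ Nat.card ((X ^ q - X : (IsLocalRing.ResidueField P)[X]).roots.toFinset) := by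
          refine Nat.card_le_card_of_injective (fun x => ⟨x.1, ?_⟩) fun x y h =>
            Subtype.ext (congrArg (fun z => z.1) h)
          rw [Multiset.mem_toFinset, mem_roots hne]
          simp [x.2]
      _ ≤ q := by
          rw [Nat.card_eq_fintype_card, Fintype.card_coe]
          refine (Multiset.toFinset_card_le _).trans ((card_roots' _).trans ?_)
          rw [FiniteField.X_pow_card_sub_X_natDegree_eq _ hq2]
  refine (card_characters_le (hv := hv) r.ne_zero hN hπ ((hvP _).mpr ξ.2) hgen (φ := φ)
    (fun g => ?_) hSres (ν := ν) fun s m hs hm => ?_).trans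
      (Nat.mul_le_mul_left _ (Nat.pow_le_pow_left hS _))
  · obtain ⟨n, hn⟩ := hφgen g
    exact ⟨n, fun c hc => (hlt _).mpr (hn c ((hvP c).mp hc))⟩
  · refine lt_of_upperRamificationGroup_eq_bot P hν (s := s) (by rwa [hram]) ?_
    have h0 := hram 0
    rw [Nat.cast_zero] at h0
    rw [h0]
    simpa only [hram] using hm

theorem two_mul_ring_choose_two (x : ℤ) : 2 * Ring.choose x 2 = x * (x - 1) := by
  have h := Ring.descPochhammer_eq_factorial_smul_choose x 2
  rw [← Polynomial.eval_eq_smeval, descPochhammer_succ_eval, descPochhammer_one,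
    Polynomial.eval_X] at h
  simpa using h.symm

end

theorem proposition4p1
    -- the finite field with `q = p ^ e` elements
    (p : ℕ) [Fact p.Prime] (e : ℕ) {F : Type*} [Field F] [Finite F] [CharP F p]
    (hq : Nat.card F = p ^ e)
    -- a function field `K` over it, and a finite abelian extension whose group is a `p`-group
    {K : Type*} [Field K] [Algebra F K] [Algebra (RatFunc F) K] [IsScalarTower F (RatFunc F) K]
    [FunctionField F K]
    {L : Type*} [Field L] [Algebra K L] [FiniteDimensional K L] [IsAbelianGalois K L]
    (hL : IsPGroup p (L ≃ₐ[K] L))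
    -- a prime `𝔭` of `K` at which the ramification depth is at most `ν`
    (𝔭 : ValuationSubring K) (h𝔭 : 𝔭 ≠ ⊤) (ν : ℕ) (hν : RamifiedOfDepthAtMost K L 𝔭 ν)
    -- a prime of `L` above `𝔭`, with decomposition group `G_𝔭`
    (P : ValuationSubring L) (hP : P.comap (algebraMap K L) = 𝔭) :
    (relationRank p (P.decompositionSubgroup K) : ℚ) - Group.rank (P.decompositionSubgroup K)
        ≤ (Ring.choose ((e * placeDegree F 𝔭 : ℤ) * ((ν : ℤ) - 1) + 1) 2 : ℤ) ∧
      ((Ring.choose ((e * placeDegree F 𝔭 : ℤ) * ((ν : ℤ) - 1) + 1) 2 : ℤ) : ℚ)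
        = ((e * placeDegree F 𝔭 : ℚ) * ((ν : ℚ) - 1)) *
            ((e * placeDegree F 𝔭 : ℚ) * ((ν : ℚ) - 1) + 1) / 2 := by
  refine ⟨?_, ?_⟩
  swap
  · have := two_mul_ring_choose_two ((e * placeDegree F 𝔭 : ℤ) * ((ν : ℤ) - 1) + 1)
    have h2 : (2 : ℚ) * ((Ring.choose ((e * placeDegree F 𝔭 : ℤ) * ((ν : ℤ) - 1) + 1) 2 : ℤ) : ℚ) =
      ((e * placeDegree F 𝔭 : ℚ) * ((ν : ℚ) - 1) + 1) *
        ((e * placeDegree F 𝔭 : ℚ) * ((ν : ℚ) - 1) + 1 - 1) := by exact_mod_cast this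
    linarith
  have hPtop : P ≠ ⊤ := by
    rintro rfl
    exact h𝔭 (by rw [← hP]; rfl)
  let : Algebra F L := ((algebraMap K L).comp (algebraMap F K)).toAlgebra
  let : Algebra (RatFunc F) L := ((algebraMap K L).comp (algebraMap (RatFunc F) K)).toAlgebra
  have : IsScalarTower (RatFunc F) K L := IsScalarTower.of_algebraMap_eq fun _ => rfl
  have : IsScalarTower F (RatFunc F) L := IsScalarTower.of_algebraMap_eq fun x =>
    congrArg (algebraMap K L) (IsScalarTower.algebraMap_apply F (RatFunc F) K x)
  have : FiniteDimensional (RatFunc F) K := ‹FunctionField F K›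
  have : FiniteDimensional (RatFunc F) L := FiniteDimensional.trans (RatFunc F) K L
  have : CharP L p := charP_of_injective_algebraMap (algebraMap F L).injective p
  obtain ⟨s, hs0, hs, _⟩ := exists_finiteDimensional_adjoin (F := F) P hPtop
  have := finite_residueField_of_finite_adjoin (F := F) P hs
  have := isDiscreteValuationRing_of_finite_adjoin (F := F) P hs0 hs
  obtain ⟨s', -, hs', _⟩ := exists_finiteDimensional_adjoin (F := F) 𝔭 h𝔭
  have : Finite (IsLocalRing.ResidueField 𝔭) := finite_residueField_of_finite_adjoin (F := F) 𝔭 hs'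
  have hcard : Nat.card (IsLocalRing.ResidueField 𝔭) = p ^ (e * placeDegree F 𝔭) := by
    let : Algebra F (IsLocalRing.ResidueField 𝔭) :=
      ((IsLocalRing.residue 𝔭).comp ((algebraMap F K).codRestrict 𝔭.toSubring
        (algebraMap_mem_valuationSubring F 𝔭))).toAlgebra
    rw [pow_mul, ← hq]
    exact Module.natCard_eq_pow_finrank
  have hchar := card_characters_decompositionSubgroup_le (p := p) P 𝔭 hP (hν P hP)
  rw [hcard, ← pow_mul, ← pow_succ'] at hchar
  have hrel := relationRank_le (fun a b => Subtype.ext (mul_comm' a.1 b.1))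
    (hL.to_subgroup _) hchar
  have hrel' : (relationRank p (P.decompositionSubgroup K) : ℚ)
      - Group.rank (P.decompositionSubgroup K) ≤
        ((e * placeDegree F 𝔭 * (ν - 1) + 1).choose 2 : ℕ) := by
    rw [sub_le_iff_le_add']
    exact_mod_cast hrel
  refine hrel'.trans ?_
  -- `ν - 1` is truncated in `hrel'`. For `ν = 0` the bound there is 1 choose 2, which is 0, while
  -- the integer binomial equals d(d-1)/2 with d = e f, nonnegative because d is a natural number.
  rcases Nat.eq_zero_or_pos ν with rfl | hν0
  · have h1 := two_mul_ring_choose_two ((e * placeDegree F 𝔭 : ℤ) * (((0 : ℕ) : ℤ) - 1) + 1)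
    have h2 : 0 ≤ (Ring.choose ((e * placeDegree F 𝔭 : ℤ) * (((0 : ℕ) : ℤ) - 1) + 1) 2 : ℤ) := by
      rw [Nat.cast_zero] at h1 ⊢
      have h3 : (0 : ℤ) ≤ (e * placeDegree F 𝔭 : ℤ) := by positivity
      generalize (e * placeDegree F 𝔭 : ℤ) = d at *
      have h4 : 0 ≤ d * (d - 1) := by
        rcases h3.eq_or_lt with h4 | h4
        · simp [← h4]
        · exact mul_nonneg h3 (by omega)
      linarith
    simpa using (show ((0 : ℤ) : ℚ) ≤ _ from Int.cast_le.mpr h2)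
  · have h1 : ((e * placeDegree F 𝔭 : ℤ) * ((ν : ℤ) - 1) + 1)
        = ((e * placeDegree F 𝔭 * (ν - 1) + 1 : ℕ) : ℤ) := by
      rw [Nat.cast_add, Nat.cast_mul, Nat.cast_sub hν0]
      push_cast
      ring
    rw [h1, Ring.choose_natCast]
    exact le_of_eq (by norm_cast)
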